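/- Let $0<p<\infty$. Let $u$ be a weight on $\mathbb R$ (a positive, locally integrable function) and let $w$ be a weight on $(0,\infty)$, i.e. $w$ is positive and $W(t):=\int_0^t w(s)\,ds<\infty$ for all $t>0$. Assume $w\in\Delta_2$: there is $C$ with $W(2r)\le C\,W(r)$ for all $r>0$. Write $u(E)=\int_E u(x)\,dx$ and $f_u^*(t)=\inf\{s>0:\ u(\{x\in\mathbb R:|f(x)|>s\})\le t\}$, and let $\Lambda^p_u(w)$ be the space of Lebesgue measurable functions $f$ on $\mathbb R$ with $$\|f\|_{\Lambda^p_u(w)}=\Big(\int_0^\infty (f_u^*(t))^p\,w(t)\,dt\Big)^{1/p}<\infty .$$ Suppose that the Hilbert transform $$Hf(x)=\frac1\pi\lim_{\varepsilon\to0^+}\int_{|x-y|>\varepsilon}\frac{f(y)}{x-y}\,dy$$ is bounded on $\Lambda^p_u(w)$, that is, for every $f\in\Lambda^p_u(w)$, $Hf(x)$ is well defined at almost every $x\in\mathbb R$ (the truncated integrals converge absolutely and the limit exists), and $\|Hf\|_{\Lambda^p_u(w)}\le C\,\|f\|_{\Lambda^p_u(w)}$ with $C$ independent of $f$. For $t\in(0,1]$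 put $$\underline{W_u}(t)=\sup\left\{\frac{W\big(u(\bigcup_j S_j)\big)}{W\big(u(\bigcup_j I_j)\big)}:\ S_j\subseteq I_j,\ |S_j|<t\,|I_j|\ \text{for every } j\right\},$$ where the supremum runs over all finite nonempty families of pairwise disjoint bounded intervals $I_j$ and measurable sets $S_j$. Then the generalized lower Boyd index $$\beta_{\Lambda^p_u(w)}:=\lim_{t\to0^+}\frac{\log \underline{W_u}(t)^{1/p}}{\log t}$$ exists as a real number and $\beta_{\Lambda^p_u(w)}>0$. -/

import Mathlib

open Set Filter Topology MeasureTheory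
open scoped NNReal ENNReal

noncomputable section

namespace WeightedLorentz

/-- The measure `u(E) = ∫_E u(x) dx` on the real line. -/
def weightMeasure (u : ℝ → ℝ) : Measure ℝ :=
  volume.withDensity fun x => ENNReal.ofReal (u x)

/-- The primitive `W(a) = ∫_0^a w(s) ds`, for `a ∈ [0, ∞]`. -/
def primitive (w : ℝ → ℝ) (a : ℝ≥0∞) : ℝ≥0∞ :=
  ∫⁻ s in {s : ℝ | 0 < s ∧ ENNReal.ofReal s ≤ a}, ENNReal.ofReal (w s)

/-- The condition `Δ₂`: `W(2r) ≤ C W(r)` for all `r > 0`. -/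
def DeltaTwo (w : ℝ → ℝ) : Prop :=
  ∃ C : ℝ≥0, ∀ r : ℝ, 0 < r →
    primitive w (ENNReal.ofReal (2 * r)) ≤ C * primitive w (ENNReal.ofReal r)

/-- The decreasing rearrangement of `f` with respect to `u`:
`f*_u(t) = inf {s > 0 : u({|f| > s}) ≤ t}`, which is `∞` if no finite `s` qualifies. -/
def rearrangement (u f : ℝ → ℝ) (t : ℝ) : ℝ≥0∞ :=
  sInf {s : ℝ≥0∞ | 0 < s ∧
    weightMeasure u {x | s < ENNReal.ofReal |f x|} ≤ ENNReal.ofReal t}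

/-- The functional `‖f‖ = (∫_0^∞ (f*_u(t))^p w(t) dt)^(1/p)`, with values in `[0, ∞]`. -/
def lorentzNorm (p : ℝ) (u w f : ℝ → ℝ) : ℝ≥0∞ :=
  (∫⁻ t in Ioi (0 : ℝ), rearrangement u f t ^ p * ENNReal.ofReal (w t)) ^ (1 / p)

/-- Membership in `Λ^p_u(w)`: `f` is Lebesgue measurable with finite functional. -/
def MemLorentz (p : ℝ) (u w f : ℝ → ℝ) : Prop :=
  AEMeasurable f volume ∧ lorentzNorm p u w f < ∞

/-- `Hf(x)` is well defined and equal to `h`: all truncated integrals converge absolutely, and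
`(1/π) ∫_{|x-y|>ε} f(y)/(x-y) dy → h` as `ε → 0⁺`. -/
def HasHilbertTransformAt (f : ℝ → ℝ) (x h : ℝ) : Prop :=
  (∀ ε : ℝ, 0 < ε → IntegrableOn (fun y => f y / (x - y)) {y | ε < |x - y|} volume) ∧
  Tendsto (fun ε : ℝ => (1 / Real.pi) * ∫ y in {y | ε < |x - y|}, f y / (x - y))
    (𝓝[>] 0) (𝓝 h)

/-- `H : Λ^p_u(w) → Λ^p_u(w)` is bounded: for each `f` in the space, `Hf` is well defined at
almost every point, and `‖Hf‖ ≤ C ‖f‖` with `C` independent of `f`. Here `g` is `Hf`, which is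
determined up to a null set. -/
def HilbertBounded (p : ℝ) (u w : ℝ → ℝ) : Prop :=
  ∃ C : ℝ≥0, ∀ f : ℝ → ℝ, MemLorentz p u w f →
    ∃ g : ℝ → ℝ, (∀ᵐ x, HasHilbertTransformAt f x (g x)) ∧
      lorentzNorm p u w g ≤ C * lorentzNorm p u w f

/-- A finite nonempty family of pairwise disjoint bounded intervals `I j` with measurable
subsets `S j` such that `|S j| < t |I j|` for every `j`. -/
structure Admissible (t : ℝ) {n : ℕ} (I S : Fin n → Set ℝ) : Prop where
  nonempty : 0 < n
  interval : ∀ j, (I j).OrdConnected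
  bounded : ∀ j, Bornology.IsBounded (I j)
  disjoint : Pairwise fun i j => Disjoint (I i) (I j)
  measurable : ∀ j, NullMeasurableSet (S j) volume
  subset : ∀ j, S j ⊆ I j
  small : ∀ j, volume (S j) < ENNReal.ofReal t * volume (I j)

/-- The function written as underlined `W_u`: the supremum of `W(u(⋃ S_j)) / W(u(⋃ I_j))` over
all admissible families. -/
def lowerW (u w : ℝ → ℝ) (t : ℝ) : ℝ≥0∞ :=
  ⨆ (n : ℕ) (I : Fin n → Set ℝ) (S : Fin n → Set ℝ) (_ : Admissible t I S),
    primitive w (weightMeasure u (⋃ j, S j)) / primitive w (weightMeasure u (⋃ j, I j))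

/-- The generalized lower Boyd index of `Λ^p_u(w)` exists and equals `β`:
`log (W_u(t)^(1/p)) / log t → β` as `t → 0⁺`. -/
def HasLowerBoydIndex (p : ℝ) (u w : ℝ → ℝ) (β : ℝ) : Prop :=
  Tendsto (fun t : ℝ => Real.log ((lowerW u w t).toReal ^ (1 / p)) / Real.log t)
    (𝓝[>] 0) (𝓝 β)

end WeightedLorentz

end

namespace WeightedLorentz

/-! ### The weighted measure `u(E)`. -/

section Weight

variable {u : ℝ → ℝ}

/-! Up to a constant, `lowerW` is submultiplicative: if `S` has density below `s * t / 2` in `I`, a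
Calderón–Zygmund stopping argument puts an intermediate set `V` between them, with density below `t`
in `I`, made of intervals in which `S` has density below `s` (`lowerW_mul_div_two_le`). Hence `n ↦
log (D * lowerW (2 * 2⁻ⁿ))` is subadditive, and Fekete's lemma gives the limit along dyadic scales.
`Δ₂` keeps it finite (`one_le_pow_mul_lowerW`), and monotonicity carries it to all `t → 0⁺`
(`tendsto_log_div_log`).

A Fekete limit is an infimum, so positivity of the index only needs `lowerW < 1 / D` at one dyadic
scale. In fact `lowerW (8⁻ᴷ)` tends to `0`. If `S` has density below `8⁻ᴷ` in `I`, iterated stopping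
yields disjoint subsets of `I` such that at each point of (a compact part of) `S` at least `K` of
their indicators have Hilbert transform at least `1 / (4π)` in modulus (`exists_layers`). With
random signs, the sum of these indicators stays bounded by `1`, while on a fixed proportion of `S`
its transform is at least a multiple of `√K` for some choice of signs. Boundedness of `H` then
bounds `W(u(S)) / W(u(I))` by a multiple of `K ^ (-p / 2)` (`lowerW_eighth_pow_le`). -/

theorem weightMeasure_absolutelyContinuous (u : ℝ → ℝ) : weightMeasure u ≪ volume :=
  withDensity_absolutelyContinuous _ _

theorem weightMeasure_lt_top (hu : LocallyIntegrable u volume) {s : Set ℝ}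
    (hs : Bornology.IsBounded s) : weightMeasure u s < ∞ := by
  have hc : IsCompact (closure s) := hs.isCompact_closure
  refine (measure_mono subset_closure).trans_lt ?_
  rw [weightMeasure, withDensity_apply _ isClosed_closure.measurableSet]
  exact (hu.integrableOn_isCompact hc).lintegral_lt_top

theorem isLocallyFiniteMeasure_weightMeasure (hu : LocallyIntegrable u volume) :
    IsLocallyFiniteMeasure (weightMeasure u) :=
  ⟨fun x => ⟨Metric.ball x 1, Metric.ball_mem_nhds x one_pos,
    weightMeasure_lt_top hu Metric.isBounded_ball⟩⟩

theorem weightMeasure_pos (hu : LocallyIntegrable u volume) (hu_pos : ∀ᵐ x, 0 < u x)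
    {s : Set ℝ} (hs : volume s ≠ 0) : 0 < weightMeasure u s := by
  have h : volume ≪ weightMeasure u :=
    withDensity_absolutelyContinuous' hu.aestronglyMeasurable.aemeasurable.ennreal_ofReal
      (hu_pos.mono fun x hx => (ENNReal.ofReal_pos.2 hx).ne')
  exact pos_iff_ne_zero.2 fun h0 => hs (h h0)

/-- Half of the weighted measure of a null-measurable bounded set is carried by a compact subset. -/
theorem exists_isCompact_weightMeasure_le (hu : LocallyIntegrable u volume) {s : Set ℝ}
    (hs : NullMeasurableSet s volume) (hb : Bornology.IsBounded s) :
    ∃ K ⊆ s, IsCompact K ∧ weightMeasure u s ≤ 2 * weightMeasure u K := by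
  have := isLocallyFiniteMeasure_weightMeasure hu
  obtain ⟨t, hts, ht, hae⟩ := hs.exists_measurable_subset_ae_eq
  have hst : weightMeasure u s = weightMeasure u t :=
    (measure_congr ((weightMeasure_absolutelyContinuous u).ae_le hae)).symm
  rcases eq_or_ne (weightMeasure u t) 0 with h0 | h0
  · exact ⟨∅, empty_subset _, isCompact_empty, by simp [hst, h0]⟩
  · have hfin : weightMeasure u t ≠ ∞ := (weightMeasure_lt_top hu (hb.subset hts)).ne
    obtain ⟨K, hK, hKc, hlt⟩ :=
      ht.exists_lt_isCompact_of_ne_top hfin (ENNReal.half_lt_self h0 hfin)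
    refine ⟨K, hK.trans hts, hKc, ?_⟩
    have := (ENNReal.div_le_iff_le_mul (by simp) (by simp)).1 hlt.le
    rwa [hst, mul_comm]

end Weight

/-! ### The primitive `W` and iterated doubling. -/

section Primitive

variable {w : ℝ → ℝ}

theorem primitive_mono (w : ℝ → ℝ) : Monotone (primitive w) := fun _ _ h =>
  lintegral_mono_set fun _ hs => ⟨hs.1, hs.2.trans h⟩

theorem primitive_zero (w : ℝ → ℝ) : primitive w 0 = 0 := by
  have : {s : ℝ | 0 < s ∧ ENNReal.ofReal s ≤ 0} = ∅ := by
    ext s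
    simp
  rw [primitive, this]
  simp

theorem primitive_ofReal (w : ℝ → ℝ) {r : ℝ} (hr : 0 ≤ r) :
    primitive w (ENNReal.ofReal r) = ∫⁻ s in Ioc 0 r, ENNReal.ofReal (w s) := by
  have : {s : ℝ | 0 < s ∧ ENNReal.ofReal s ≤ ENNReal.ofReal r} = Ioc 0 r := by
    ext s
    simp [ENNReal.ofReal_le_ofReal_iff hr]
  rw [primitive, this]

theorem primitive_lt_top (hw : ∀ t : ℝ, 0 < t → IntegrableOn w (Ioc 0 t) volume) {a : ℝ≥0∞}
    (ha : a ≠ ∞) : primitive w a < ∞ := by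
  rcases eq_or_ne a 0 with rfl | h0
  · simp [primitive_zero]
  · rw [← ENNReal.ofReal_toReal ha, primitive_ofReal w ENNReal.toReal_nonneg]
    exact (hw _ (ENNReal.toReal_pos h0 ha)).lintegral_lt_top

theorem primitive_pos (hw : ∀ t : ℝ, 0 < t → IntegrableOn w (Ioc 0 t) volume)
    (hw_pos : ∀ᵐ t ∂(volume.restrict (Ioi (0 : ℝ))), 0 < w t) {a : ℝ≥0∞} (ha : 0 < a) :
    0 < primitive w a := by
  obtain ⟨r, -, hr, hra⟩ := ENNReal.lt_iff_exists_real_btwn.1 ha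
  refine lt_of_lt_of_le ?_ (primitive_mono w hra.le)
  have hr0 : 0 < r := ENNReal.ofReal_pos.1 hr
  rw [primitive_ofReal w hr0.le, pos_iff_ne_zero, Ne,
    lintegral_eq_zero_iff' (hw r hr0).aemeasurable.ennreal_ofReal]
  intro h
  have h' : ∀ᵐ t ∂(volume.restrict (Ioc 0 r)), 0 < w t :=
    ae_restrict_of_ae_restrict_of_subset Ioc_subset_Ioi_self hw_pos
  have hF : ∀ᵐ t ∂(volume.restrict (Ioc 0 r)), False := by
    filter_upwards [h, h'] with t h1 h2
    simp only [Pi.zero_apply, ENNReal.ofReal_eq_zero] at h1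
    linarith
  rw [ae_iff] at hF
  simp at hF
  linarith

theorem primitive_two_mul_le {C : ℝ≥0}
    (hC : ∀ r : ℝ, 0 < r →
      primitive w (ENNReal.ofReal (2 * r)) ≤ C * primitive w (ENNReal.ofReal r))
    {a : ℝ≥0∞} (ha : a ≠ ∞) : primitive w (2 * a) ≤ C * primitive w a := by
  rcases eq_or_ne a 0 with rfl | h0
  · simp [primitive_zero]
  · have := hC a.toReal (ENNReal.toReal_pos h0 ha)
    rwa [ENNReal.ofReal_mul zero_le_two, ENNReal.ofReal_toReal ha, ENNReal.ofReal_ofNat] at this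

theorem primitive_two_pow_mul_le {C : ℝ≥0}
    (hC : ∀ r : ℝ, 0 < r →
      primitive w (ENNReal.ofReal (2 * r)) ≤ C * primitive w (ENNReal.ofReal r))
    {a : ℝ≥0∞} (ha : a ≠ ∞) (n : ℕ) : primitive w (2 ^ n * a) ≤ C ^ n * primitive w a := by
  induction n with
  | zero => simp
  | succ n ih =>
    rw [pow_succ', mul_assoc, pow_succ', mul_assoc]
    refine (primitive_two_mul_le hC (ENNReal.mul_ne_top (by simp) ha)).trans ?_
    gcongr

end Primitive

/-! ### The Lorentz functional on indicator-like functions. -/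

section Norm

variable {p : ℝ} {u w : ℝ → ℝ}

/-- The rearrangement is at most `1` and vanishes once `t` exceeds `u(E)`, so the integrand is at
most `w` on `(0, u(E)]` and zero beyond. -/
theorem lorentzNorm_le_of_abs_le_indicator (hp : 0 < p) {f : ℝ → ℝ} {E : Set ℝ}
    (hf : ∀ x, |f x| ≤ E.indicator 1 x) :
    lorentzNorm p u w f ≤ primitive w (weightMeasure u E) ^ (1 / p) := by
  refine ENNReal.rpow_le_rpow ?_ (by positivity)
  set A : Set ℝ := {s : ℝ | 0 < s ∧ ENNReal.ofReal s ≤ weightMeasure u E} with hA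
  have hAm : MeasurableSet A :=
    (measurableSet_lt measurable_const measurable_id).inter
      (measurableSet_le ENNReal.measurable_ofReal measurable_const)
  have hone : ∀ x, ENNReal.ofReal |f x| ≤ 1 := fun x => by
    rw [← ENNReal.ofReal_one]
    refine ENNReal.ofReal_le_ofReal ((hf x).trans ?_)
    exact indicator_le_self' (fun _ _ => zero_le_one) x
  calc ∫⁻ t in Ioi (0 : ℝ), rearrangement u f t ^ p * ENNReal.ofReal (w t)
      ≤ ∫⁻ t in Ioi (0 : ℝ), A.indicator (fun t => ENNReal.ofReal (w t)) t := by
        refine setLIntegral_mono' measurableSet_Ioi fun t ht => ?_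
        by_cases htA : t ∈ A
        · rw [indicator_of_mem htA]
          have h1 : rearrangement u f t ≤ 1 := by
            refine sInf_le ⟨one_pos, ?_⟩
            have : {x | 1 < ENNReal.ofReal |f x|} = ∅ := by
              ext x
              simpa using hone x
            rw [this, measure_empty]
            exact bot_le
          calc rearrangement u f t ^ p * ENNReal.ofReal (w t)
              ≤ 1 ^ p * ENNReal.ofReal (w t) := by gcongr
            _ = ENNReal.ofReal (w t) := by simp
        · have hlt : weightMeasure u E < ENNReal.ofReal t := by
            by_contra hcon
            exact htA ⟨ht, not_lt.1 hcon⟩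
          have h0 : rearrangement u f t = 0 := by
            refine le_antisymm (le_of_forall_gt_imp_ge_of_dense fun s hs => ?_) bot_le
            refine sInf_le ⟨hs, le_trans (measure_mono fun x hx => ?_) hlt.le⟩
            by_contra hxE
            have := hf x
            rw [indicator_of_notMem hxE] at this
            have h2 : ENNReal.ofReal |f x| = 0 := ENNReal.ofReal_eq_zero.2 this
            simp [h2] at hx
          simp [h0, ENNReal.zero_rpow_of_pos hp]
    _ ≤ primitive w (weightMeasure u E) := by
        rw [primitive, ← hA, ← lintegral_indicator hAm]
        exact setLIntegral_le_lintegral _ _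

/-- For `t ≤ r < u(G)` no level below `l` qualifies in the rearrangement. The strict inequality lets
`G` be an arbitrary set and is paid for later by a slightly worse constant. -/
theorem mul_primitive_rpow_le_lorentzNorm (hp : 0 < p) {g : ℝ → ℝ} {G : Set ℝ} {l : ℝ} {r : ℝ≥0∞}
    (hg : ∀ x ∈ G, l ≤ |g x|) (hr : r < weightMeasure u G) :
    ENNReal.ofReal l * primitive w r ^ (1 / p) ≤ lorentzNorm p u w g := by
  have key : ENNReal.ofReal l ^ p * primitive w r ≤
      ∫⁻ t in Ioi (0 : ℝ), rearrangement u g t ^ p * ENNReal.ofReal (w t) := by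
    refine (lintegral_const_mul_le _ _).trans ?_
    refine le_trans (setLIntegral_mono' ?_ fun t ht => ?_)
      (lintegral_mono_set (fun t ht => ht.1 : {s : ℝ | 0 < s ∧ ENNReal.ofReal s ≤ r} ⊆ Ioi 0))
    · exact (measurableSet_lt measurable_const measurable_id).inter
        (measurableSet_le ENNReal.measurable_ofReal measurable_const)
    · gcongr
      refine le_sInf fun s hs => ?_
      by_contra hlt
      rw [not_le] at hlt
      have : weightMeasure u G ≤ weightMeasure u {x | s < ENNReal.ofReal |g x|} :=
        measure_mono fun x hx => hlt.trans_le (ENNReal.ofReal_le_ofReal (hg x hx))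
      exact absurd (this.trans (hs.2.trans ht.2)) (not_le.2 hr)
  calc ENNReal.ofReal l * primitive w r ^ (1 / p)
      = (ENNReal.ofReal l ^ p * primitive w r) ^ (1 / p) := by
        rw [ENNReal.mul_rpow_of_nonneg _ _ (by positivity), ← ENNReal.rpow_mul,
          mul_one_div_cancel hp.ne', ENNReal.rpow_one]
    _ ≤ _ := ENNReal.rpow_le_rpow key (by positivity)

end Norm

end WeightedLorentz

namespace WeightedLorentz

/-! ### Bounded intervals and their bisection. -/

section Intervals

variable {I : Set ℝ}

theorem exists_endpoints (hI : I.OrdConnected) (hb : Bornology.IsBounded I) :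
    ∃ a b : ℝ, a ≤ b ∧ Ioo a b ⊆ I ∧ I ⊆ Icc a b := by
  rcases I.eq_empty_or_nonempty with rfl | hne
  · exact ⟨0, 0, le_rfl, by simp, by simp⟩
  · have h := subset_Icc_csInf_csSup hb.bddBelow hb.bddAbove
    obtain ⟨x, hx⟩ := hne
    refine ⟨sInf I, sSup I, (h hx).1.trans (h hx).2, fun y hy => ?_, h⟩
    obtain ⟨c, hc, hcy⟩ := exists_lt_of_csInf_lt ⟨x, hx⟩ hy.1
    obtain ⟨d, hd, hyd⟩ := exists_lt_of_lt_csSup ⟨x, hx⟩ hy.2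
    exact hI.out hc hd ⟨hcy.le, hyd.le⟩

theorem volume_real_eq_of_subset {a b : ℝ} (hab : a ≤ b) (h1 : Ioo a b ⊆ I)
    (h2 : I ⊆ Icc a b) : volume.real I = b - a := by
  refine le_antisymm ?_ ?_
  · have := measureReal_mono (μ := volume) h2 (by simp)
    rwa [Real.volume_real_Icc_of_le hab] at this
  · have := measureReal_mono (μ := volume) h1
      ((measure_mono h2).trans_lt (by simp)).ne
    rwa [Real.volume_real_Ioo_of_le hab] at this

theorem abs_sub_le_volume_real (hI : I.OrdConnected) (hb : Bornology.IsBounded I) {x y : ℝ}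
    (hx : x ∈ I) (hy : y ∈ I) : |x - y| ≤ volume.real I := by
  obtain ⟨a, b, hab, h1, h2⟩ := exists_endpoints hI hb
  rw [volume_real_eq_of_subset hab h1 h2, abs_le]
  have hx := h2 hx
  have hy := h2 hy
  constructor <;> linarith [hx.1, hx.2, hy.1, hy.2]

theorem exists_bisection (hI : I.OrdConnected) (hb : Bornology.IsBounded I) :
    ∃ m : ℝ, volume.real (I ∩ Iio m) = volume.real I / 2 ∧
      volume.real (I ∩ Ici m) = volume.real I / 2 := by
  obtain ⟨a, b, hab, h1, h2⟩ := exists_endpoints hI hb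
  refine ⟨(a + b) / 2, ?_, ?_⟩
  · rw [volume_real_eq_of_subset hab h1 h2,
      volume_real_eq_of_subset (a := a) (b := (a + b) / 2) (by linarith)]
    · ring
    · exact fun y hy => ⟨h1 ⟨hy.1, by linarith [hy.2]⟩, hy.2⟩
    · exact fun y hy => ⟨(h2 hy.1).1, le_of_lt hy.2⟩
  · rw [volume_real_eq_of_subset hab h1 h2,
      volume_real_eq_of_subset (a := (a + b) / 2) (b := b) (by linarith)]
    · ring
    · exact fun y hy => ⟨h1 ⟨by linarith [hy.1], hy.2⟩, hy.1.le⟩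
    · exact fun y hy => ⟨hy.2, (h2 hy.1).2⟩

end Intervals

/-! ### Calderón–Zygmund stopping intervals. -/

section Stopping

variable {S U : Set ℝ} {δ s : ℝ}

/-- Bisect until `U` has density at least `s / 2`; halving at most doubles the density, so it stays
below `s`. The process ends because an interval shorter than `δ` that meets `S` lies inside `U`,
where the density is `1`; `N` counts the bisections available. -/
theorem exists_stopping_family_of_lt (hδ : ∀ x ∈ S, Metric.ball x δ ⊆ U) (hs : s ≤ 1) (N : ℕ) :
    ∀ I : Set ℝ, I.OrdConnected → Bornology.IsBounded I → volume.real I < 2 ^ N * δ →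
      volume.real (U ∩ I) < s * volume.real I →
      ∃ F : Finset (Set ℝ), (∀ J ∈ F, J.OrdConnected ∧ J ⊆ I ∧
          s / 2 * volume.real J ≤ volume.real (U ∩ J) ∧
          volume.real (U ∩ J) < s * volume.real J) ∧
        (F : Set (Set ℝ)).PairwiseDisjoint id ∧ S ∩ I ⊆ ⋃ J ∈ F, J := by
  classical
  induction N with
  | zero =>
    intro I hI hb hlt hU
    refine ⟨∅, by simp, by simp, fun x hx => ?_⟩
    have hIU : I ⊆ U := fun y hy => hδ x hx.1 (by
      rw [Metric.mem_ball, Real.dist_eq]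
      exact (abs_sub_le_volume_real hI hb hy hx.2).trans_lt (by simpa using hlt))
    rw [inter_eq_self_of_subset_right hIU] at hU
    nlinarith [measureReal_nonneg (μ := volume) (s := I)]
  | succ N ih =>
    intro I hI hb hlt hU
    by_cases hdense : s / 2 * volume.real I ≤ volume.real (U ∩ I)
    · exact ⟨{I}, by simp [hI, hU, hdense], by simp, by simp⟩
    · rw [not_le] at hdense
      have hfin : volume (U ∩ I) ≠ ∞ := (hb.subset inter_subset_right).measure_lt_top.ne
      obtain ⟨m, hl, hr⟩ := exists_bisection hI hb
      rw [pow_succ] at hlt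
      obtain ⟨F, hF, hFd, hFc⟩ := ih (I ∩ Iio m) (hI.inter ordConnected_Iio)
        (hb.subset inter_subset_left) (by rw [hl]; linarith) (by
          have := measureReal_mono (μ := volume)
            (inter_subset_inter_right U (inter_subset_left (s := I) (t := Iio m))) hfin
          rw [hl]; linarith)
      obtain ⟨G, hG, hGd, hGc⟩ := ih (I ∩ Ici m) (hI.inter ordConnected_Ici)
        (hb.subset inter_subset_left) (by rw [hr]; linarith) (by
          have := measureReal_mono (μ := volume)
            (inter_subset_inter_right U (inter_subset_left (s := I) (t := Ici m))) hfin
          rw [hr]; linarith)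
      refine ⟨F ∪ G, fun J hJ => ?_, ?_, fun x hx => ?_⟩
      · rcases Finset.mem_union.1 hJ with h | h
        · exact ⟨(hF J h).1, (hF J h).2.1.trans inter_subset_left, (hF J h).2.2⟩
        · exact ⟨(hG J h).1, (hG J h).2.1.trans inter_subset_left, (hG J h).2.2⟩
      · rw [Finset.coe_union]
        refine hFd.union hGd fun J hJ L hL _ => ?_
        refine Disjoint.mono (hF J hJ).2.1 (hG L hL).2.1 (disjoint_left.2 fun y hy hy' => ?_)
        exact not_lt.2 (mem_Ici.1 hy'.2) (mem_Iio.1 hy.2)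
      · rw [Finset.set_biUnion_union]
        rcases lt_or_ge x m with h | h
        · exact Or.inl (hFc ⟨hx.1, hx.2, h⟩)
        · exact Or.inr (hGc ⟨hx.1, hx.2, h⟩)

/-- A Calderón–Zygmund stopping family: finitely many disjoint intervals cover `S ∩ I`, and `U`
has density less than `s` in each, but at least `s / 2` in their union. -/
theorem exists_stopping_family (hUm : MeasurableSet U) (hδ0 : 0 < δ)
    (hδ : ∀ x ∈ S, Metric.ball x δ ⊆ U) (hs : s ≤ 1)
    {I : Set ℝ} (hI : I.OrdConnected) (hb : Bornology.IsBounded I)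
    (hU : volume.real (U ∩ I) < s * volume.real I) :
    ∃ F : Finset (Set ℝ), (∀ J ∈ F, J.OrdConnected ∧ J ⊆ I ∧
        volume.real (U ∩ J) < s * volume.real J) ∧
      (F : Set (Set ℝ)).PairwiseDisjoint id ∧ S ∩ I ⊆ ⋃ J ∈ F, J ∧
      s / 2 * volume.real (⋃ J ∈ F, J) ≤ volume.real (U ∩ I) := by
  obtain ⟨N, hN⟩ := pow_unbounded_of_one_lt (volume.real I / δ) (one_lt_two (α := ℝ))
  rw [div_lt_iff₀ hδ0] at hN
  obtain ⟨F, hF, hFd, hFc⟩ := exists_stopping_family_of_lt hδ hs N I hI hb hN hU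
  refine ⟨F, fun J hJ => ⟨(hF J hJ).1, (hF J hJ).2.1, (hF J hJ).2.2.2⟩, hFd, hFc, ?_⟩
  have hfin : ∀ J ∈ F, volume J ≠ ∞ := fun J hJ => (hb.subset (hF J hJ).2.1).measure_lt_top.ne
  have hvol : volume.real (⋃ J ∈ F, J) = ∑ J ∈ F, volume.real J :=
    measureReal_biUnion_finset hFd (fun J hJ => (hF J hJ).1.measurableSet) hfin
  rw [hvol, Finset.mul_sum]
  have hdU : (F : Set (Set ℝ)).PairwiseDisjoint fun J => U ∩ J := fun J hJ L hL h =>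
    (hFd hJ hL h).mono inter_subset_right inter_subset_right
  calc ∑ J ∈ F, s / 2 * volume.real J ≤ ∑ J ∈ F, volume.real (U ∩ J) :=
        Finset.sum_le_sum fun J hJ => (hF J hJ).2.2.1
    _ = volume.real (⋃ J ∈ F, U ∩ J) :=
        (measureReal_biUnion_finset hdU (fun J hJ => hUm.inter (hF J hJ).1.measurableSet)
          fun J hJ => measure_ne_top_of_subset inter_subset_right (hfin J hJ)).symm
    _ ≤ volume.real (U ∩ I) := measureReal_mono
        (iUnion₂_subset fun J hJ => inter_subset_inter_right U (hF J hJ).2.1)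
        (hb.subset inter_subset_right).measure_lt_top.ne

/-- Passing from `S` to an open neighbourhood of nearly the same volume supplies, by compactness,
the uniform radius that makes the bisection terminate. -/
theorem exists_measurable_ball_subset (hS : IsCompact S) {r : ℝ} (hr : volume.real S < r) :
    ∃ U : Set ℝ, MeasurableSet U ∧ (∀ I, volume.real (U ∩ I) < r) ∧
      ∃ δ > 0, ∀ x ∈ S, Metric.ball x δ ⊆ U := by
  have hlt : volume S < ENNReal.ofReal r := by
    rw [← ENNReal.ofReal_toReal hS.measure_lt_top.ne]
    exact (ENNReal.ofReal_lt_ofReal_iff (measureReal_nonneg.trans_lt hr)).2 hr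
  obtain ⟨U, hSU, hU, hUr⟩ := S.exists_isOpen_lt_of_lt _ hlt
  obtain ⟨δ, hδ, hδU⟩ := hS.exists_thickening_subset_open hU hSU
  refine ⟨U, hU.measurableSet, fun I => ?_, δ, hδ, fun x hx => ?_⟩
  · refine (measureReal_mono inter_subset_left (hUr.trans ENNReal.ofReal_lt_top).ne).trans_lt ?_
    have := (ENNReal.toReal_lt_toReal hUr.ne_top ENNReal.ofReal_ne_top).2 hUr
    rwa [ENNReal.toReal_ofReal (measureReal_nonneg.trans hr.le)] at this
  · exact (Metric.ball_subset_thickening hx δ).trans hδU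

end Stopping

/-! ### Lower bound for the Hilbert transform of a one-sided set. -/

section Hilbert

/-- With `A` on one side of `x` there is no cancellation: the kernel has constant sign and modulus
at least `1 / l` on `A`. -/
theorem HasHilbertTransformAt.le_mul_of_one_side {A : Set ℝ} (hA : MeasurableSet A) {x h l σ : ℝ}
    (hl : 0 < l) (hσ : ∀ y ∈ A, 0 ≤ σ * (x - y)) (hσ1 : |σ| = 1) (hAl : ∀ y ∈ A, |x - y| ≤ l)
    (hh : HasHilbertTransformAt (A.indicator 1) x h) :
    volume.real A / (Real.pi * l) ≤ σ * h := by
  have hπ := Real.pi_pos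
  have hAb : A ⊆ Metric.closedBall x l := fun y hy => by
    rw [Metric.mem_closedBall, Real.dist_eq, abs_sub_comm]
    exact hAl y hy
  have hAfin : volume A ≠ ∞ := measure_ne_top_of_subset hAb measure_closedBall_lt_top.ne
  have hlim : Tendsto (fun ε : ℝ => (volume.real A - 2 * ε) / (Real.pi * l)) (𝓝[>] 0)
      (𝓝 (volume.real A / (Real.pi * l))) := by
    have : Tendsto (fun ε : ℝ => (volume.real A - 2 * ε) / (Real.pi * l)) (𝓝 0)
        (𝓝 ((volume.real A - 2 * 0) / (Real.pi * l))) :=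
      Continuous.tendsto (by fun_prop) 0
    simpa using this.mono_left nhdsWithin_le_nhds
  refine le_of_tendsto_of_tendsto hlim (hh.2.const_mul σ) ?_
  filter_upwards [self_mem_nhdsWithin] with ε hε
  have hε : 0 < ε := hε
  set D : Set ℝ := {y | ε < |x - y|} with hD
  have hDm : MeasurableSet D := measurableSet_lt measurable_const (by fun_prop)
  -- The truncation removes at most an interval of length `2 * ε`.
  have h1 : volume.real A - 2 * ε ≤ volume.real (A ∩ D) := by
    have hsub : A ⊆ A ∩ D ∪ Metric.closedBall x ε := fun y hy => by
      by_cases hyD : y ∈ D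
      · exact Or.inl ⟨hy, hyD⟩
      · right
        rw [Metric.mem_closedBall, Real.dist_eq, abs_sub_comm]
        exact not_lt.1 hyD
    have h2 : volume.real A ≤ volume.real (A ∩ D) + volume.real (Metric.closedBall x ε) :=
      (measureReal_mono hsub (measure_union_lt_top
        (measure_ne_top_of_subset inter_subset_left hAfin).lt_top
        measure_closedBall_lt_top).ne).trans (measureReal_union_le _ _)
    rw [Real.volume_real_closedBall hε.le] at h2
    linarith
  have h2 : volume.real (A ∩ D) / l ≤ ∫ y in D, σ * (A.indicator 1 y / (x - y)) := by
    have h3 : ∫ y in D, A.indicator (fun _ => 1 / l) y = volume.real (A ∩ D) / l := by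
      rw [setIntegral_indicator hA, setIntegral_const, inter_comm D A, smul_eq_mul]
      ring
    rw [← h3]
    refine setIntegral_mono_on ?_ ((hh.1 ε hε).const_mul σ) hDm fun y hy => ?_
    · exact ((integrable_indicator_iff hA).2 (integrableOn_const hAfin)).integrableOn
    · by_cases hyA : y ∈ A
      · rw [indicator_of_mem hyA, indicator_of_mem hyA]
        have hne : x - y ≠ 0 := fun h0 => by
          simp only [hD, mem_ofPred_eq, h0, abs_zero] at hy
          linarith
        have h4 : σ * (x - y) = |x - y| := by
          rw [← abs_of_nonneg (hσ y hyA), abs_mul, hσ1, one_mul]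
        have h5 : σ * ((1 : ℝ → ℝ) y / (x - y)) = 1 / |x - y| := by
          have hσ2 : σ * σ = 1 := by rw [← abs_mul_abs_self, hσ1, one_mul]
          rw [← h4, Pi.one_apply, eq_div_iff (by rw [h4]; exact abs_ne_zero.2 hne)]
          field_simp
          linarith
        rw [h5]
        exact one_div_le_one_div_of_le (abs_pos.2 hne) (hAl y hyA)
      · simp [indicator_of_notMem hyA]
  rw [integral_const_mul] at h2
  calc (volume.real A - 2 * ε) / (Real.pi * l) ≤ volume.real (A ∩ D) / (Real.pi * l) := by gcongr
    _ = 1 / Real.pi * (volume.real (A ∩ D) / l) := by field_simp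
    _ ≤ 1 / Real.pi * (σ * ∫ y in D, A.indicator 1 y / (x - y)) := by gcongr
    _ = _ := by ring

theorem HasHilbertTransformAt.le_abs_of_one_side {A : Set ℝ} (hA : MeasurableSet A) {x h l : ℝ}
    (hl : 0 < l) (hside : (∀ y ∈ A, y ≤ x) ∨ ∀ y ∈ A, x ≤ y) (hAl : ∀ y ∈ A, |x - y| ≤ l)
    (hh : HasHilbertTransformAt (A.indicator 1) x h) :
    volume.real A / (Real.pi * l) ≤ |h| := by
  rcases hside with hs | hs
  · have := hh.le_mul_of_one_side hA hl (σ := 1) (fun y hy => by linarith [hs y hy]) (by simp) hAl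
    exact this.trans (by simpa using le_abs_self h)
  · have := hh.le_mul_of_one_side hA hl (σ := -1) (fun y hy => by linarith [hs y hy]) (by simp) hAl
    exact this.trans (by simpa using neg_le_abs h)

end Hilbert

end WeightedLorentz

namespace WeightedLorentz

/-! ### Layers of sets with large Hilbert transforms. -/

section Layers

variable {S U : Set ℝ} {δ : ℝ}

/-- If `U` has density less than `8⁻ᴷ` in `I`, then `I` contains finitely many disjoint sets such
that at each point of `S ∩ I` at least `K` of their indicators have a large Hilbert transform. -/
theorem exists_layers (hUm : MeasurableSet U) (hδ0 : 0 < δ)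
    (hδ : ∀ x ∈ S, Metric.ball x δ ⊆ U) (K : ℕ) :
    ∀ I : Set ℝ, I.OrdConnected → Bornology.IsBounded I →
      volume.real (U ∩ I) < (1 / 8) ^ K * volume.real I →
      ∃ (ι : Type) (_ : Fintype ι) (A : ι → Set ℝ), (∀ i, MeasurableSet (A i)) ∧ (∀ i, A i ⊆ I) ∧
        (Pairwise fun i j => Disjoint (A i) (A j)) ∧ ∀ x ∈ S ∩ I, ∃ T : Finset ι, K ≤ T.card ∧
          ∀ i ∈ T, ∀ h, HasHilbertTransformAt ((A i).indicator 1) x h →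
            1 / (4 * Real.pi) ≤ |h| := by
  induction K with
  | zero =>
    intro I _ _ _
    exact ⟨Empty, inferInstance, fun _ => ∅, fun i => i.elim, fun i => i.elim, fun i => i.elim,
      fun _ _ => ⟨∅, by simp, by simp⟩⟩
  | succ K ih =>
    intro I hI hb hU
    have hI0 : 0 < volume.real I :=
      pos_of_mul_pos_right (measureReal_nonneg.trans_lt hU) (by positivity)
    have h8 : (0 : ℝ) < (1 / 8) ^ K := by positivity
    rw [pow_succ] at hU
    -- Stopping at density `8⁻ᴷ` prepares the induction inside each `J`. Moreover `8⁻ᴷ / 2 * |V| ≤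
    -- |U ∩ I| < 8⁻ᴷ / 8 * |I|`, so the union `V` fills at most a quarter of `I`.
    obtain ⟨F, hF, hFd, hFc, hFv⟩ := exists_stopping_family hUm hδ0 hδ
      (pow_le_one₀ (by norm_num) (by norm_num) : (1 / 8 : ℝ) ^ K ≤ 1) hI hb
      (hU.trans_le (by nlinarith [mul_pos h8 hI0]))
    set V : Set ℝ := ⋃ J ∈ F, J with hV
    have hVm : MeasurableSet V := F.measurableSet_biUnion fun J hJ => (hF J hJ).1.measurableSet
    have hVI : V ⊆ I := iUnion₂_subset fun J hJ => (hF J hJ).2.1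
    have hVle : volume.real V ≤ volume.real I / 4 := by
      by_contra hcon
      rw [not_le] at hcon
      nlinarith [mul_lt_mul_of_pos_left hcon h8]
    obtain ⟨m, hl, hr⟩ := exists_bisection hI hb
    have hJ : ∀ J : F, ∃ (ι : Type) (_ : Fintype ι) (A : ι → Set ℝ), (∀ i, MeasurableSet (A i)) ∧
        (∀ i, A i ⊆ J.1) ∧ (Pairwise fun i j => Disjoint (A i) (A j)) ∧ ∀ x ∈ S ∩ J.1, ∃ T : Finset ι,
          K ≤ T.card ∧ ∀ i ∈ T, ∀ h, HasHilbertTransformAt ((A i).indicator 1) x h →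
            1 / (4 * Real.pi) ≤ |h| := fun J =>
      ih J.1 (hF J.1 J.2).1 (hb.subset (hF J.1 J.2).2.1) (hF J.1 J.2).2.2
    choose ι hι A hAm hAJ hAd hAT using hJ
    let H : Bool → Set ℝ := fun b => if b then Iio m else Ici m
    have hHm : ∀ b, MeasurableSet (H b) := by
      intro b
      cases b
      · exact measurableSet_Ici
      · exact measurableSet_Iio
    have hHd : Disjoint (H true) (H false) :=
      disjoint_left.2 fun y hy hy' => not_lt.2 (mem_Ici.1 hy') (mem_Iio.1 hy)
    have hHv : ∀ b, volume.real (I ∩ H b) = volume.real I / 2 := by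
      intro b
      cases b
      · exact hr
      · exact hl
    -- The new layer is `I \ V` cut at the midpoint. Each piece has volume at least `|I| / 2 - |I| /
    -- 4`, and all deeper sets lie in `V`.
    let B : (Bool ⊕ Σ J : F, ι J) → Set ℝ :=
      Sum.elim (fun b => (I \ V) ∩ H b) fun q => A q.1 q.2
    have hAV : ∀ q : Σ J : F, ι J, A q.1 q.2 ⊆ V := fun q =>
      (hAJ q.1 q.2).trans (subset_biUnion_of_mem (u := fun J => J) q.1.2)
    have hBV : ∀ b, Disjoint (B (Sum.inl b)) V := fun b =>
      disjoint_sdiff_left.mono_left inter_subset_left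
    have hBb : ∀ b, volume.real I / 4 ≤ volume.real (B (Sum.inl b)) := by
      intro b
      have h1 : I ∩ H b ⊆ B (Sum.inl b) ∪ V := fun y hy => by
        by_cases hyV : y ∈ V
        · exact Or.inr hyV
        · exact Or.inl ⟨⟨hy.1, hyV⟩, hy.2⟩
      have h2 : B (Sum.inl b) ∪ V ⊆ I :=
        union_subset (inter_subset_left.trans sdiff_subset) hVI
      have h3 := (measureReal_mono (μ := volume) h1 (hb.subset h2).measure_lt_top.ne).trans
        (measureReal_union_le _ _)
      rw [hHv] at h3
      linarith
    refine ⟨Bool ⊕ Σ J : F, ι J, inferInstance, B, ?_, ?_, ?_, ?_⟩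
    · rintro (b | q)
      · exact (hI.measurableSet.diff hVm).inter (hHm b)
      · exact hAm q.1 q.2
    · rintro (b | q)
      · exact inter_subset_left.trans sdiff_subset
      · exact (hAV q).trans hVI
    · rintro (b | q) (b' | q') hne
      · have hbb : Disjoint (H b) (H b') := by
          cases b <;> cases b'
          · exact absurd rfl hne
          · exact hHd.symm
          · exact hHd
          · exact absurd rfl hne
        exact hbb.mono inter_subset_right inter_subset_right
      · exact (hBV b).mono_right (hAV q')
      · exact ((hBV b').mono_right (hAV q)).symm
      · obtain ⟨J, i⟩ := q
        obtain ⟨J', i'⟩ := q'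
        by_cases hJJ : J = J'
        · subst hJJ
          exact hAd J fun h => hne (by obtain rfl : i = i' := h; rfl)
        · exact (hFd J.2 J'.2 fun h => hJJ (Subtype.ext h)).mono (hAJ J i) (hAJ J' i')
    · rintro x ⟨hxS, hxI⟩
      obtain ⟨J, hJF, hxJ⟩ := mem_iUnion₂.1 (hFc ⟨hxS, hxI⟩)
      obtain ⟨T, hTc, hT⟩ := hAT ⟨J, hJF⟩ x ⟨hxS, hxJ⟩
      -- The half across the midpoint from `x` is entirely on one side of `x`; it contributes `(|I|
      -- / 4) / (π * |I|)`.
      obtain ⟨b, hside⟩ : ∃ b, (∀ y ∈ B (Sum.inl b), y ≤ x) ∨ ∀ y ∈ B (Sum.inl b), x ≤ y := by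
        rcases le_or_gt m x with hmx | hmx
        · exact ⟨true, Or.inl fun y hy => (mem_Iio.1 hy.2).le.trans hmx⟩
        · exact ⟨false, Or.inr fun y hy => hmx.le.trans (mem_Ici.1 hy.2)⟩
      refine ⟨Finset.disjSum {b} (T.map (Function.Embedding.sigmaMk ⟨J, hJF⟩)), ?_, ?_⟩
      · rw [Finset.card_disjSum, Finset.card_singleton, Finset.card_map]
        omega
      · intro i hi h hh
        rcases Finset.mem_disjSum.1 hi with ⟨b', hb', rfl⟩ | ⟨q, hq, rfl⟩
        · rw [Finset.mem_singleton.1 hb'] at hh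
          have hBm : MeasurableSet (B (Sum.inl b)) := (hI.measurableSet.diff hVm).inter (hHm b)
          refine le_trans ?_ (hh.le_abs_of_one_side hBm hI0 hside fun y hy =>
            abs_sub_le_volume_real hI hb hxI hy.1.1)
          rw [div_le_div_iff₀ (by positivity) (by positivity)]
          nlinarith [mul_le_mul_of_nonneg_left (hBb b) Real.pi_pos.le]
        · obtain ⟨i, hiT, rfl⟩ := Finset.mem_map.1 hq
          exact hT i hiT h hh

end Layers

/-! ### Moments of Rademacher sums. -/

section Signs

variable {ι : Type} [Fintype ι]

/-- The sign attached to a Boolean. -/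
def boolSign (b : Bool) : ℝ := if b then 1 else -1

theorem boolSign_not (b : Bool) : boolSign (!b) = -boolSign b := by
  cases b <;> simp [boolSign]

theorem boolSign_sq (b : Bool) : boolSign b ^ 2 = 1 := by
  cases b <;> simp [boolSign]

theorem abs_boolSign (b : Bool) : |boolSign b| = 1 := by
  cases b <;> simp [boolSign]

open Classical in
-- Flipping the `i`-th sign is an involution of the sign patterns that negates each summand.
theorem sum_boolSign_mul_eq_zero (i : ι) (G : (ι → Bool) → ℝ)
    (hG : ∀ σ, G (Function.update σ i (!σ i)) = G σ) :
    ∑ σ : ι → Bool, boolSign (σ i) * G σ = 0 := by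
  have hinv : Function.Involutive fun σ : ι → Bool => Function.update σ i (!σ i) := by
    intro σ
    simp
  have h := Equiv.sum_comp hinv.toPerm fun σ : ι → Bool => boolSign (σ i) * G σ
  simp only [Function.Involutive.coe_toPerm, Function.update_self, boolSign_not, hG,
    neg_mul, Finset.sum_neg_distrib] at h
  linarith

open Classical in
-- When a term is added to the sum, odd powers of the new sign average out. In the fourth moment the
-- cross term `6 * a i ^ 2` times the old variance is exactly the cross term of `3 * V ^ 2`.
theorem sum_boolSign_pow (a : ι → ℝ) (s : Finset ι) :
    (∑ σ : ι → Bool, (∑ i ∈ s, boolSign (σ i) * a i) ^ 2 =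
      Fintype.card (ι → Bool) * ∑ i ∈ s, a i ^ 2) ∧
    ∑ σ : ι → Bool, (∑ i ∈ s, boolSign (σ i) * a i) ^ 4 ≤
      3 * Fintype.card (ι → Bool) * (∑ i ∈ s, a i ^ 2) ^ 2 := by
  induction s using Finset.induction_on with
  | empty => simp
  | insert i s hi ih =>
    set X : (ι → Bool) → ℝ := fun σ => ∑ j ∈ s, boolSign (σ j) * a j with hX
    have hflip : ∀ σ, X (Function.update σ i (!σ i)) = X σ := fun σ =>
      Finset.sum_congr rfl fun j hj => by
        rw [Function.update_of_ne (ne_of_mem_of_not_mem hj hi)]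
    have h1 := sum_boolSign_mul_eq_zero i X hflip
    have h3 := sum_boolSign_mul_eq_zero i (fun σ => X σ ^ 3) fun σ => by rw [hflip]
    simp only [Finset.sum_insert hi]
    have e2 : ∀ σ : ι → Bool, (boolSign (σ i) * a i + X σ) ^ 2 =
        X σ ^ 2 + 2 * a i * (boolSign (σ i) * X σ) + a i ^ 2 := fun σ => by
      linear_combination a i ^ 2 * boolSign_sq (σ i)
    have e4 : ∀ σ : ι → Bool, (boolSign (σ i) * a i + X σ) ^ 4 =
        X σ ^ 4 + 4 * a i * (boolSign (σ i) * X σ ^ 3) + 6 * a i ^ 2 * X σ ^ 2 +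
          4 * a i ^ 3 * (boolSign (σ i) * X σ) + a i ^ 4 := fun σ => by
      have h := boolSign_sq (σ i)
      linear_combination (a i ^ 4 * (boolSign (σ i) ^ 2 + 1) +
        4 * a i ^ 3 * boolSign (σ i) * X σ + 6 * a i ^ 2 * X σ ^ 2) * h
    have ih2 : ∑ σ, X σ ^ 2 = Fintype.card (ι → Bool) * ∑ j ∈ s, a j ^ 2 := ih.1
    have ih4 : ∑ σ, X σ ^ 4 ≤ 3 * Fintype.card (ι → Bool) * (∑ j ∈ s, a j ^ 2) ^ 2 := ih.2
    constructor
    · change ∑ σ : ι → Bool, (boolSign (σ i) * a i + X σ) ^ 2 = _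
      simp only [e2, Finset.sum_add_distrib, ← Finset.mul_sum, h1, ih2, Finset.sum_const,
        Finset.card_univ, nsmul_eq_mul]
      ring
    · change ∑ σ : ι → Bool, (boolSign (σ i) * a i + X σ) ^ 4 ≤ _
      simp only [e4, Finset.sum_add_distrib, ← Finset.mul_sum, h1, h3, ih2, Finset.sum_const,
        Finset.card_univ, nsmul_eq_mul]
      have hN : (0 : ℝ) ≤ Fintype.card (ι → Bool) := Nat.cast_nonneg _
      nlinarith [mul_nonneg hN (sq_nonneg (a i ^ 2))]

open Classical in
/-- A Rademacher sum is at least a fixed multiple of its standard deviation with probability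
at least `1 / 12`. -/
theorem card_le_card_filter_boolSign (a : ι → ℝ) :
    Fintype.card (ι → Bool) ≤ 12 * (Finset.univ.filter fun σ : ι → Bool =>
      (∑ i, a i ^ 2) / 2 ≤ (∑ i, boolSign (σ i) * a i) ^ 2).card := by
  obtain ⟨h2, h4⟩ := sum_boolSign_pow a Finset.univ
  set V := ∑ i, a i ^ 2
  set X : (ι → Bool) → ℝ := fun σ => ∑ i, boolSign (σ i) * a i
  set T := Finset.univ.filter fun σ : ι → Bool => V / 2 ≤ X σ ^ 2 with hT
  set N : ℝ := ((Fintype.card (ι → Bool) : ℕ) : ℝ) with hN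
  have hNpos : 0 < N := by
    rw [hN]
    exact_mod_cast Fintype.card_pos
  have hV : 0 ≤ V := Finset.sum_nonneg fun i _ => sq_nonneg _
  rcases hV.eq_or_lt with h0 | hVpos
  · have : T = Finset.univ := Finset.filter_true_of_mem fun σ _ => by
      rw [← h0]
      simp only [zero_div]
      positivity
    rw [this, Finset.card_univ]
    omega
  -- Paley–Zygmund: patterns outside `T` carry at most half of the second moment, so `T` carries `N
  -- * V / 2`. Cauchy–Schwarz and the fourth moment give `(N * V / 2) ^ 2 ≤ |T| * 3 * N * V ^ 2`,
  -- whence the `12`.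
  · have hsplit := Finset.sum_filter_add_sum_filter_not Finset.univ (fun σ => V / 2 ≤ X σ ^ 2)
      fun σ => X σ ^ 2
    have hsmall : ∑ σ with ¬V / 2 ≤ X σ ^ 2, X σ ^ 2 ≤ N * (V / 2) := by
      calc ∑ σ with ¬V / 2 ≤ X σ ^ 2, X σ ^ 2 ≤ ∑ σ with ¬V / 2 ≤ X σ ^ 2, V / 2 :=
            Finset.sum_le_sum fun σ hσ => (not_le.1 (Finset.mem_filter.1 hσ).2).le
        _ ≤ ∑ σ : ι → Bool, V / 2 :=
            Finset.sum_le_sum_of_subset_of_nonneg (Finset.filter_subset _ _)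
              fun _ _ _ => by positivity
        _ = N * (V / 2) := by simp [hN]
    have hbig : N * V / 2 ≤ ∑ σ ∈ T, X σ ^ 2 := by
      change ∑ σ, X σ ^ 2 = N * V at h2
      linarith
    have hcs := sq_sum_le_card_mul_sum_sq (s := T) (f := fun σ => X σ ^ 2)
    have h4' : ∑ σ ∈ T, (X σ ^ 2) ^ 2 ≤ 3 * N * V ^ 2 := by
      refine le_trans ?_ h4
      calc ∑ σ ∈ T, (X σ ^ 2) ^ 2 ≤ ∑ σ, (X σ ^ 2) ^ 2 :=
            Finset.sum_le_sum_of_subset_of_nonneg (Finset.filter_subset _ _)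
              fun _ _ _ => by positivity
        _ = ∑ σ, X σ ^ 4 := Finset.sum_congr rfl fun σ _ => by ring
    have hsq : (N * V / 2) ^ 2 ≤ (∑ σ ∈ T, X σ ^ 2) ^ 2 :=
      pow_le_pow_left₀ (by positivity) hbig 2
    have hfin : (N * V / 2) ^ 2 ≤ T.card * (3 * N * V ^ 2) :=
      hsq.trans (hcs.trans (by gcongr))
    have : N ≤ 12 * T.card := by
      by_contra hcon
      rw [not_le] at hcon
      have hNV : 0 < N * V ^ 2 := by positivity
      nlinarith [mul_lt_mul_of_pos_left hcon hNV]
    rw [hN] at this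
    exact_mod_cast this

end Signs

/-! ### Choosing a good sign pattern by averaging. -/

section Averaging

open Classical in
-- Integrating the number of `E ω` containing `x` shows that the average of `μ (E ω)` is at least `μ
-- S / 12`. Measurable hulls replace the `E ω`, which need not be measurable.
theorem exists_measure_le_mul {Ω : Type} [Fintype Ω] [Nonempty Ω] (μ : Measure ℝ) {S : Set ℝ}
    (hS : MeasurableSet S) (E : Ω → Set ℝ)
    (h : ∀ᵐ x ∂μ, x ∈ S →
      Fintype.card Ω ≤ 12 * (Finset.univ.filter fun ω => x ∈ E ω).card) :
    ∃ ω, μ S ≤ 12 * μ (E ω) := by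
  have hsum : ∑ _ω : Ω, μ S ≤ ∑ ω : Ω, 12 * μ (E ω) := by
    calc ∑ _ω : Ω, μ S = ∫⁻ x, S.indicator (fun _ => (Fintype.card Ω : ℝ≥0∞)) x ∂μ := by
          rw [lintegral_indicator_const hS]
          simp
      _ ≤ ∫⁻ x, ∑ ω : Ω, 12 * (toMeasurable μ (E ω)).indicator 1 x ∂μ := by
          refine lintegral_mono_ae (h.mono fun x hx => ?_)
          by_cases hxS : x ∈ S
          · rw [indicator_of_mem hxS, ← Finset.mul_sum]
            calc (Fintype.card Ω : ℝ≥0∞)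
                ≤ 12 * ((Finset.univ.filter fun ω => x ∈ E ω).card : ℝ≥0∞) := by
                  exact_mod_cast hx hxS
              _ = 12 * ∑ ω with x ∈ E ω, (1 : ℝ≥0∞) := by simp
              _ ≤ 12 * ∑ ω : Ω, (toMeasurable μ (E ω)).indicator 1 x := by
                  gcongr
                  rw [Finset.sum_filter]
                  refine Finset.sum_le_sum fun ω _ => ?_
                  split_ifs with hxE
                  · rw [indicator_of_mem (subset_toMeasurable μ _ hxE)]
                    rfl
                  · exact bot_le
          · rw [indicator_of_notMem hxS]
            exact bot_le
      _ = ∑ ω : Ω, 12 * μ (E ω) := by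
          have hm : ∀ ω, Measurable ((toMeasurable μ (E ω)).indicator (1 : ℝ → ℝ≥0∞)) :=
            fun ω => measurable_one.indicator (measurableSet_toMeasurable _ _)
          rw [lintegral_finsetSum _ fun ω _ => (hm ω).const_mul 12]
          refine Finset.sum_congr rfl fun ω _ => ?_
          rw [lintegral_const_mul _ (hm ω),
            lintegral_indicator_one (measurableSet_toMeasurable _ _), measure_toMeasurable]
  by_contra! hcon
  exact absurd hsum (not_le.2 (ENNReal.sum_lt_sum_of_nonempty Finset.univ_nonempty
    fun ω _ => hcon ω))

end Averaging

/-! ### Uniqueness and linearity of the pointwise transform. -/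

section Linearity

variable {x : ℝ}

theorem HasHilbertTransformAt.unique {f : ℝ → ℝ} {h k : ℝ} (hh : HasHilbertTransformAt f x h)
    (hk : HasHilbertTransformAt f x k) : h = k :=
  tendsto_nhds_unique hh.2 hk.2

theorem HasHilbertTransformAt.sum {ι : Type} (s : Finset ι) (c : ι → ℝ) {f : ι → ℝ → ℝ}
    {h : ι → ℝ} (hf : ∀ i, HasHilbertTransformAt (f i) x (h i)) :
    HasHilbertTransformAt (fun y => ∑ i ∈ s, c i * f i y) x (∑ i ∈ s, c i * h i) := by
  have heq : ∀ y, (∑ i ∈ s, c i * f i y) / (x - y) = ∑ i ∈ s, c i * (f i y / (x - y)) :=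
    fun y => by
      rw [Finset.sum_div]
      exact Finset.sum_congr rfl fun i _ => by ring
  have hint : ∀ ε : ℝ, 0 < ε → ∀ i ∈ s, IntegrableOn (fun y => c i * (f i y / (x - y)))
      {y | ε < |x - y|} volume := fun ε hε i _ => ((hf i).1 ε hε).const_mul (c i)
  constructor
  · intro ε hε
    simp only [heq]
    exact integrable_finsetSum _ (hint ε hε)
  · refine (tendsto_finsetSum s fun i _ => (hf i).2.const_mul (c i)).congr' ?_
    filter_upwards [self_mem_nhdsWithin] with ε hε
    simp only [heq]
    rw [integral_finsetSum s (hint ε hε), Finset.mul_sum]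
    refine Finset.sum_congr rfl fun i _ => ?_
    rw [integral_const_mul]
    ring

end Linearity

end WeightedLorentz

namespace WeightedLorentz

variable {p : ℝ} {u w : ℝ → ℝ}

/-! ### Testing the boundedness of `H` on random signs. -/

section RandomSigns

/-- Disjointness leaves at most one nonzero term at each point, so the test function has size at
most `1` however many layers it uses. -/
theorem abs_sum_boolSign_mul_indicator_le {ι : Type} [Fintype ι] {A : ι → Set ℝ} {E : Set ℝ}
    (hAE : ∀ i, A i ⊆ E) (hAd : Pairwise fun i j => Disjoint (A i) (A j)) (σ : ι → Bool) (x : ℝ) :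
    |∑ i, boolSign (σ i) * (A i).indicator 1 x| ≤ E.indicator 1 x := by
  by_cases h : ∃ i, x ∈ A i
  · obtain ⟨i, hi⟩ := h
    rw [Finset.sum_eq_single i, indicator_of_mem hi, indicator_of_mem (hAE i hi)]
    · simp [abs_boolSign]
    · intro j _ hj
      rw [indicator_of_notMem fun hxj => disjoint_left.1 (hAd hj) hxj hi, mul_zero]
    · simp
  · push Not at h
    rw [Finset.sum_eq_zero fun i _ => by rw [indicator_of_notMem (h i), mul_zero], abs_zero]
    exact indicator_nonneg (fun _ _ => zero_le_one) x

/-- If at every point of `S` at least `K` of the Hilbert transforms of the indicators of disjoint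
subsets of `E` are at least `c`, then boundedness on a random signed sum of these indicators
compares `S` with `E`. -/
theorem ofReal_mul_primitive_rpow_le (hp : 0 < p) (hu : LocallyIntegrable u volume)
    (hw : ∀ t : ℝ, 0 < t → IntegrableOn w (Ioc 0 t) volume) {C : ℝ≥0}
    (hH : ∀ f : ℝ → ℝ, MemLorentz p u w f →
      ∃ g : ℝ → ℝ, (∀ᵐ x, HasHilbertTransformAt f x (g x)) ∧
        lorentzNorm p u w g ≤ C * lorentzNorm p u w f)
    {ι : Type} [Fintype ι] {A : ι → Set ℝ} {E S : Set ℝ} (hE : Bornology.IsBounded E)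
    (hAm : ∀ i, MeasurableSet (A i)) (hAE : ∀ i, A i ⊆ E)
    (hAd : Pairwise fun i j => Disjoint (A i) (A j)) (hS : MeasurableSet S) (hSE : S ⊆ E)
    {c : ℝ} (hc : 0 ≤ c) {K : ℕ}
    (hT : ∀ x ∈ S, ∃ T : Finset ι, K ≤ T.card ∧
      ∀ i ∈ T, ∀ h, HasHilbertTransformAt ((A i).indicator 1) x h → c ≤ |h|) :
    ENNReal.ofReal (c * √(K / 2)) * primitive w (weightMeasure u S / 16) ^ (1 / p) ≤
      C * primitive w (weightMeasure u E) ^ (1 / p) := by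
  classical
  have hEfin : weightMeasure u E ≠ ∞ := (weightMeasure_lt_top hu hE).ne
  have hSfin : weightMeasure u S ≠ ∞ := (weightMeasure_lt_top hu (hE.subset hSE)).ne
  rcases eq_or_ne (weightMeasure u S) 0 with h0 | h0
  · rw [h0, ENNReal.zero_div, primitive_zero, ENNReal.zero_rpow_of_pos (by positivity), mul_zero]
    exact bot_le
  have hmem : ∀ f : ℝ → ℝ, Measurable f → (∀ x, |f x| ≤ E.indicator 1 x) → MemLorentz p u w f :=
    fun f hf hfE => ⟨hf.aemeasurable, (lorentzNorm_le_of_abs_le_indicator hp hfE).trans_lt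
      (ENNReal.rpow_lt_top_of_nonneg (by positivity) (primitive_lt_top hw hEfin).ne)⟩
  have hAi : ∀ i, Measurable ((A i).indicator (1 : ℝ → ℝ)) := fun i =>
    measurable_one.indicator (hAm i)
  have hatom : ∀ i, ∃ g : ℝ → ℝ, ∀ᵐ x, HasHilbertTransformAt ((A i).indicator 1) x (g x) := by
    intro i
    obtain ⟨g, hg, -⟩ := hH _ (hmem _ (hAi i) fun x => by
      have hnn : 0 ≤ (A i).indicator (1 : ℝ → ℝ) x := indicator_nonneg (fun _ _ => zero_le_one) x
      rw [abs_of_nonneg hnn]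
      exact indicator_le_indicator_of_subset (hAE i) (fun _ => zero_le_one) x)
    exact ⟨g, hg⟩
  choose k hk using hatom
  have hsum : ∀ σ : ι → Bool, ∃ g : ℝ → ℝ, (∀ᵐ x, HasHilbertTransformAt
        (fun y => ∑ i, boolSign (σ i) * (A i).indicator 1 y) x (g x)) ∧
      lorentzNorm p u w g ≤ C * primitive w (weightMeasure u E) ^ (1 / p) := by
    intro σ
    have hfE := abs_sum_boolSign_mul_indicator_le hAE hAd σ
    obtain ⟨g, hg, hgn⟩ := hH _ (hmem (fun y => ∑ i, boolSign (σ i) * (A i).indicator 1 y)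
      (Finset.measurable_sum _ fun i _ => (hAi i).const_mul _) hfE)
    refine ⟨g, hg, hgn.trans ?_⟩
    gcongr
    exact lorentzNorm_le_of_abs_le_indicator hp hfE
  choose g hg hgn using hsum
  -- At a point of `S` the variance of the signed sum is at least `K * c ^ 2`; `l ^ 2` is half of
  -- that.
  set l : ℝ := c * √(K / 2) with hl
  have hl0 : 0 ≤ l := by positivity
  obtain ⟨σ, hσ⟩ := exists_measure_le_mul (weightMeasure u) hS (fun σ => {x | l ≤ |g σ x|}) (by
    have hk' := ae_all_iff.2 hk
    have hg' := ae_all_iff.2 hg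
    filter_upwards [(weightMeasure_absolutelyContinuous u).ae_le hk',
      (weightMeasure_absolutelyContinuous u).ae_le hg'] with x hkx hgx hxS
    refine (card_le_card_filter_boolSign fun i => k i x).trans ?_
    refine Nat.mul_le_mul_left _ (Finset.card_le_card fun σ hσ => ?_)
    have hle := (Finset.mem_filter.1 hσ).2
    refine Finset.mem_filter.2 ⟨Finset.mem_univ σ, ?_⟩
    have hgk : g σ x = ∑ i, boolSign (σ i) * k i x :=
      (hgx σ).unique (HasHilbertTransformAt.sum Finset.univ (fun i => boolSign (σ i)) hkx)
    obtain ⟨T, hTK, hTc⟩ := hT x hxS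
    have hKT : K * c ^ 2 ≤ ∑ i, k i x ^ 2 := by
      calc K * c ^ 2 ≤ T.card * c ^ 2 := by gcongr
        _ = ∑ i ∈ T, c ^ 2 := by simp
        _ ≤ ∑ i ∈ T, k i x ^ 2 := Finset.sum_le_sum fun i hi =>
            sq_le_sq.2 (by rw [abs_of_nonneg hc]; exact hTc i hi _ (hkx i))
        _ ≤ ∑ i, k i x ^ 2 := Finset.sum_le_sum_of_subset_of_nonneg (Finset.subset_univ T)
            fun _ _ _ => sq_nonneg _
    have hl2 : l ^ 2 = K * c ^ 2 / 2 := by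
      rw [hl, mul_pow, Real.sq_sqrt (by positivity)]
      ring
    rw [hgk, ← abs_of_nonneg hl0]
    exact sq_le_sq.1 (by linarith))
  refine (mul_primitive_rpow_le_lorentzNorm hp (G := {x | l ≤ |g σ x|}) (fun x hx => hx) ?_).trans
    (hgn σ)
  -- Averaging gives `1 / 12`, but a strict inequality is needed; `16` is the next power of `2`,
  -- convenient for `Δ₂`.
  calc weightMeasure u S / 16 < weightMeasure u S / 12 := by
        rw [div_eq_mul_inv, div_eq_mul_inv]
        exact ENNReal.mul_lt_mul_right h0 hSfin (ENNReal.inv_lt_inv.2 (by norm_num))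
    _ ≤ _ := ENNReal.div_le_of_le_mul' hσ

end RandomSigns

/-! ### Elementary properties of `lowerW`. -/

section LowerW

variable {t : ℝ} {n : ℕ} {I S : Fin n → Set ℝ}

theorem Admissible.volume_real_lt (h : Admissible t I S) (ht : 0 ≤ t) (j : Fin n) :
    volume.real (S j) < t * volume.real (I j) := by
  have hI : volume (I j) ≠ ∞ := (h.bounded j).measure_lt_top.ne
  have := (ENNReal.toReal_lt_toReal (h.small j).ne_top
    (ENNReal.mul_ne_top ENNReal.ofReal_ne_top hI)).2 (h.small j)
  rwa [ENNReal.toReal_mul, ENNReal.toReal_ofReal ht] at this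

theorem Admissible.primitive_pos (h : Admissible t I S) (hu : LocallyIntegrable u volume)
    (hu_pos : ∀ᵐ x, 0 < u x) (hw : ∀ t : ℝ, 0 < t → IntegrableOn w (Ioc 0 t) volume)
    (hw_pos : ∀ᵐ t ∂(volume.restrict (Ioi (0 : ℝ))), 0 < w t) :
    0 < primitive w (weightMeasure u (⋃ j, I j)) := by
  refine WeightedLorentz.primitive_pos hw hw_pos (weightMeasure_pos hu hu_pos fun h0 => ?_)
  have hj := h.small ⟨0, h.nonempty⟩
  rw [measure_mono_null (subset_iUnion I _) h0, mul_zero] at hj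
  exact not_lt_bot hj

/-- The stopping argument needs compact sets. Since the `I j` are disjoint, the losses of half the
weighted measure add up, and one application of `Δ₂` absorbs them. -/
theorem Admissible.exists_isCompact (h : Admissible t I S) (hu : LocallyIntegrable u volume) :
    ∃ L : Fin n → Set ℝ, (∀ j, L j ⊆ S j) ∧ (∀ j, IsCompact (L j)) ∧
      weightMeasure u (⋃ j, S j) ≤ 2 * weightMeasure u (⋃ j, L j) := by
  choose L hLS hL hLu using fun j =>
    exists_isCompact_weightMeasure_le hu (h.measurable j) ((h.bounded j).subset (h.subset j))
  refine ⟨L, hLS, hL, (measure_iUnion_le _).trans ?_⟩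
  rw [measure_iUnion (fun i j hij => (h.disjoint hij).mono ((hLS i).trans (h.subset i))
    ((hLS j).trans (h.subset j))) fun j => (hL j).measurableSet, tsum_fintype, tsum_fintype,
    Finset.mul_sum]
  exact Finset.sum_le_sum fun j _ => hLu j

theorem lowerW_mono (u w : ℝ → ℝ) : Monotone (lowerW u w) := by
  intro s t hst
  refine iSup_le fun n => iSup_le fun I => iSup_le fun S => iSup_le fun h => ?_
  have h' : Admissible t I S := ⟨h.nonempty, h.interval, h.bounded, h.disjoint, h.measurable,
    h.subset, fun j => (h.small j).trans_le (by gcongr)⟩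
  exact le_iSup_of_le n (le_iSup_of_le I (le_iSup_of_le S (le_iSup_of_le h' le_rfl)))

theorem lowerW_le_one (u w : ℝ → ℝ) (t : ℝ) : lowerW u w t ≤ 1 := by
  refine iSup_le fun n => iSup_le fun I => iSup_le fun S => iSup_le fun h => ?_
  refine ENNReal.div_le_of_le_mul ?_
  rw [one_mul]
  exact primitive_mono w (measure_mono (iUnion_mono h.subset))

/-- An arbitrary finite index type, possibly empty, accommodates the two-level families produced by
stopping inside each `I j`. -/
theorem primitive_le_lowerW_mul (hu : LocallyIntegrable u volume)
    (hu_pos : ∀ᵐ x, 0 < u x) (hw : ∀ t : ℝ, 0 < t → IntegrableOn w (Ioc 0 t) volume)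
    (hw_pos : ∀ᵐ t ∂(volume.restrict (Ioi (0 : ℝ))), 0 < w t)
    {κ : Type} [Fintype κ] {I S : κ → Set ℝ} (ht : 0 ≤ t)
    (hI : ∀ j, (I j).OrdConnected) (hb : ∀ j, Bornology.IsBounded (I j))
    (hd : Pairwise fun i j => Disjoint (I i) (I j)) (hS : ∀ j, MeasurableSet (S j))
    (hSI : ∀ j, S j ⊆ I j) (hlt : ∀ j, volume.real (S j) < t * volume.real (I j)) :
    primitive w (weightMeasure u (⋃ j, S j)) ≤
      lowerW u w t * primitive w (weightMeasure u (⋃ j, I j)) := by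
  rcases isEmpty_or_nonempty κ with hκ | hκ
  · simp [primitive_zero]
  let e := (Fintype.equivFin κ).symm
  have h : Admissible t (I ∘ e) (S ∘ e) := by
    refine ⟨Fintype.card_pos, fun j => hI _, fun j => hb _, fun i j hij => hd (e.injective.ne hij),
      fun j => (hS _).nullMeasurableSet, fun j => hSI _, fun j => ?_⟩
    have hIfin : volume (I (e j)) ≠ ∞ := (hb (e j)).measure_lt_top.ne
    have hSfin : volume (S (e j)) ≠ ∞ := measure_ne_top_of_subset (hSI _) hIfin
    rw [Function.comp_apply, Function.comp_apply, ← ENNReal.toReal_lt_toReal hSfin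
      (ENNReal.mul_ne_top ENNReal.ofReal_ne_top hIfin), ENNReal.toReal_mul,
      ENNReal.toReal_ofReal ht]
    exact hlt _
  have hpos := h.primitive_pos hu hu_pos hw hw_pos
  have hbd : Bornology.IsBounded (⋃ j, (I ∘ e) j) := Bornology.isBounded_iUnion.2 h.bounded
  have hfin := primitive_lt_top hw (weightMeasure_lt_top hu hbd).ne
  have hle : primitive w (weightMeasure u (⋃ j, (S ∘ e) j)) /
      primitive w (weightMeasure u (⋃ j, (I ∘ e) j)) ≤ lowerW u w t :=
    le_iSup_of_le _ (le_iSup_of_le _ (le_iSup_of_le _ (le_iSup_of_le h le_rfl)))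
  rw [ENNReal.div_le_iff_le_mul (Or.inl hpos.ne') (Or.inl hfin.ne)] at hle
  have hS' : ⋃ j, (S ∘ e) j = ⋃ j, S j := e.surjective.iUnion_comp S
  have hI' : ⋃ j, (I ∘ e) j = ⋃ j, I j := e.surjective.iUnion_comp I
  rwa [hS', hI'] at hle

end LowerW

end WeightedLorentz

namespace WeightedLorentz

variable {p : ℝ} {u w : ℝ → ℝ}

/-! ### Decay, quasi-submultiplicativity and lower bound for `lowerW`. -/

section LowerWBounds

theorem lowerW_eighth_pow_le (hp : 0 < p) (hu : LocallyIntegrable u volume)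
    (hw : ∀ t : ℝ, 0 < t → IntegrableOn w (Ioc 0 t) volume) {D : ℝ≥0}
    (hD : ∀ r : ℝ, 0 < r →
      primitive w (ENNReal.ofReal (2 * r)) ≤ D * primitive w (ENNReal.ofReal r)) {C : ℝ≥0}
    (hH : ∀ f : ℝ → ℝ, MemLorentz p u w f →
      ∃ g : ℝ → ℝ, (∀ᵐ x, HasHilbertTransformAt f x (g x)) ∧
        lorentzNorm p u w g ≤ C * lorentzNorm p u w f) {K : ℕ} (hK : 0 < K) :
    lowerW u w ((1 / 8) ^ K) ≤
      D ^ 5 * (C : ℝ≥0∞) ^ p / ENNReal.ofReal (1 / (4 * Real.pi) * √(K / 2)) ^ p := by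
  have hπ := Real.pi_pos
  have hl : 0 < 1 / (4 * Real.pi) * √((K : ℝ) / 2) := by positivity
  refine iSup_le fun n => iSup_le fun I => iSup_le fun S => iSup_le fun h => ?_
  obtain ⟨L, hLS, hL, hLu⟩ := h.exists_isCompact hu
  have hA : ∀ j, ∃ (ι : Type) (_ : Fintype ι) (A : ι → Set ℝ), (∀ i, MeasurableSet (A i)) ∧
      (∀ i, A i ⊆ I j) ∧ (Pairwise fun i j => Disjoint (A i) (A j)) ∧
      ∀ x ∈ L j ∩ I j, ∃ T : Finset ι, K ≤ T.card ∧
        ∀ i ∈ T, ∀ h, HasHilbertTransformAt ((A i).indicator 1) x h →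
          1 / (4 * Real.pi) ≤ |h| := by
    intro j
    have hlt : volume.real (L j) < (1 / 8) ^ K * volume.real (I j) :=
      (measureReal_mono (hLS j) (measure_ne_top_of_subset (h.subset j)
        (h.bounded j).measure_lt_top.ne)).trans_lt (h.volume_real_lt (by positivity) j)
    obtain ⟨U, hUm, hU, δ, hδ0, hδ⟩ := exists_measurable_ball_subset (hL j) hlt
    exact exists_layers hUm hδ0 hδ K (I j) (h.interval j) (h.bounded j) (hU _)
  choose ι hι A hAm hAI hAd hAT using hA
  have hLI : ∀ j, L j ⊆ I j := fun j => (hLS j).trans (h.subset j)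
  have key := ofReal_mul_primitive_rpow_le hp hu hw hH (ι := Σ j, ι j) (A := fun q => A q.1 q.2)
    (E := ⋃ j, I j) (S := ⋃ j, L j) (Bornology.isBounded_iUnion.2 h.bounded)
    (fun q => hAm q.1 q.2) (fun q => (hAI q.1 q.2).trans (subset_iUnion I q.1))
    (by
      rintro ⟨j, i⟩ ⟨j', i'⟩ hne
      by_cases hjj : j = j'
      · subst hjj
        exact hAd j fun h => hne (by obtain rfl : i = i' := h; rfl)
      · exact (h.disjoint hjj).mono (hAI j i) (hAI j' i'))
    (MeasurableSet.iUnion fun j => (hL j).measurableSet) (iUnion_mono hLI)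
    (c := 1 / (4 * Real.pi)) (K := K) (by positivity) (by
      intro x hx
      obtain ⟨j, hxj⟩ := mem_iUnion.1 hx
      obtain ⟨T, hTK, hT⟩ := hAT j x ⟨hxj, hLI j hxj⟩
      refine ⟨T.map (Function.Embedding.sigmaMk j), by rwa [Finset.card_map], fun q hq => ?_⟩
      obtain ⟨i, hi, rfl⟩ := Finset.mem_map.1 hq
      exact hT i hi)
  set l : ℝ := 1 / (4 * Real.pi) * √((K : ℝ) / 2)
  set a := weightMeasure u (⋃ j, L j) with ha
  set b := primitive w (weightMeasure u (⋃ j, I j)) with hb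
  have hafin : a ≠ ∞ := (weightMeasure_lt_top hu
    ((Bornology.isBounded_iUnion.2 h.bounded).subset (iUnion_mono hLI))).ne
  have hkey : ENNReal.ofReal l ^ p * primitive w (a / 16) ≤ (C : ℝ≥0∞) ^ p * b := by
    have := ENNReal.rpow_le_rpow key hp.le
    rwa [ENNReal.mul_rpow_of_nonneg _ _ hp.le, ENNReal.mul_rpow_of_nonneg _ _ hp.le,
      ← ENNReal.rpow_mul, ← ENNReal.rpow_mul, one_div_mul_cancel hp.ne', ENNReal.rpow_one,
      ENNReal.rpow_one] at this
  -- Five doublings: one for the compact subsets and four for the division by `16`.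
  have hS : primitive w (weightMeasure u (⋃ j, S j)) ≤ D ^ 5 * primitive w (a / 16) := by
    refine (primitive_mono w (hLu.trans (le_of_eq ?_))).trans (primitive_two_pow_mul_le hD
      (ENNReal.div_ne_top hafin (by norm_num)) 5)
    have h32 : (2 : ℝ≥0∞) ^ 5 = 2 * 16 := by norm_num
    rw [h32, mul_assoc, ENNReal.mul_div_cancel (by norm_num) (by norm_num)]
  have hl0 : ENNReal.ofReal l ^ p ≠ 0 :=
    (ENNReal.rpow_pos (ENNReal.ofReal_pos.2 hl) ENNReal.ofReal_ne_top).ne'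
  have hltop : ENNReal.ofReal l ^ p ≠ ∞ := ENNReal.rpow_ne_top_of_nonneg hp.le ENNReal.ofReal_ne_top
  rw [ENNReal.le_div_iff_mul_le (Or.inl hl0) (Or.inl hltop), ENNReal.div_eq_inv_mul, mul_assoc]
  rw [← ENNReal.div_eq_inv_mul]
  refine ENNReal.div_le_of_le_mul ?_
  calc primitive w (weightMeasure u (⋃ j, S j)) * ENNReal.ofReal l ^ p
      ≤ D ^ 5 * primitive w (a / 16) * ENNReal.ofReal l ^ p := by gcongr
    _ = D ^ 5 * (ENNReal.ofReal l ^ p * primitive w (a / 16)) := by ring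
    _ ≤ D ^ 5 * ((C : ℝ≥0∞) ^ p * b) := by gcongr
    _ = D ^ 5 * (C : ℝ≥0∞) ^ p * b := by ring

theorem tendsto_lowerW_eighth_pow (hp : 0 < p) (hu : LocallyIntegrable u volume)
    (hw : ∀ t : ℝ, 0 < t → IntegrableOn w (Ioc 0 t) volume) (hw_delta : DeltaTwo w)
    (hH : HilbertBounded p u w) :
    Tendsto (fun K : ℕ => lowerW u w ((1 / 8) ^ K)) atTop (𝓝 0) := by
  obtain ⟨D, hD⟩ := hw_delta
  obtain ⟨C, hC⟩ := hH
  have hl : Tendsto (fun K : ℕ => 1 / (4 * Real.pi) * √((K : ℝ) / 2)) atTop atTop :=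
    (Real.tendsto_sqrt_atTop.comp
      (tendsto_natCast_atTop_atTop.atTop_div_const two_pos)).const_mul_atTop
      (by have := Real.pi_pos; positivity)
  have hl2 : Tendsto (fun K : ℕ => ENNReal.ofReal (1 / (4 * Real.pi) * √((K : ℝ) / 2)) ^ p) atTop
      (𝓝 ∞) := by
    have := ((ENNReal.continuous_rpow_const (y := p)).tendsto ∞).comp
      (ENNReal.tendsto_ofReal_atTop.comp hl)
    rwa [ENNReal.top_rpow_of_pos hp] at this
  have hlim := ENNReal.Tendsto.const_div (a := D ^ 5 * (C : ℝ≥0∞) ^ p) hl2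
    (Or.inr (ENNReal.mul_ne_top (by simp) (ENNReal.rpow_ne_top_of_nonneg hp.le (by simp))))
  rw [ENNReal.div_top] at hlim
  refine tendsto_of_tendsto_of_tendsto_of_le_of_le' tendsto_const_nhds hlim
    (Eventually.of_forall fun _ => bot_le) ?_
  filter_upwards [eventually_gt_atTop 0] with K hK
  exact lowerW_eighth_pow_le hp hu hw hD hC hK

/-- Insert the stopping intervals at density `s` between the two families. Their union has `s / 2 *
|V| < s * t / 2 * |I|`, so it is admissible for `t` inside `I`, while the compact sets are
admissible for `s` inside the stopping intervals. The factor `D` pays for compactness. -/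
theorem lowerW_mul_div_two_le (hu : LocallyIntegrable u volume)
    (hu_pos : ∀ᵐ x, 0 < u x) (hw : ∀ t : ℝ, 0 < t → IntegrableOn w (Ioc 0 t) volume)
    (hw_pos : ∀ᵐ t ∂(volume.restrict (Ioi (0 : ℝ))), 0 < w t) {D : ℝ≥0}
    (hD : ∀ r : ℝ, 0 < r →
      primitive w (ENNReal.ofReal (2 * r)) ≤ D * primitive w (ENNReal.ofReal r))
    {s t : ℝ} (hs0 : 0 < s) (hs : s ≤ 1) (ht0 : 0 < t) (ht : t ≤ 1) :
    lowerW u w (s * t / 2) ≤ D * (lowerW u w s * lowerW u w t) := by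
  refine iSup_le fun n => iSup_le fun I => iSup_le fun S => iSup_le fun h => ?_
  obtain ⟨L, hLS, hL, hLu⟩ := h.exists_isCompact hu
  have hLI : ∀ j, L j ⊆ I j := fun j => (hLS j).trans (h.subset j)
  have hF : ∀ j, ∃ F : Finset (Set ℝ), (∀ J ∈ F, J.OrdConnected ∧ J ⊆ I j ∧
        volume.real (L j ∩ J) < s * volume.real J) ∧
      (F : Set (Set ℝ)).PairwiseDisjoint id ∧ L j ⊆ ⋃ J ∈ F, J ∧
      volume.real (⋃ J ∈ F, J) < t * volume.real (I j) := by
    intro j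
    have hlt : volume.real (L j) < s * t / 2 * volume.real (I j) :=
      (measureReal_mono (hLS j) (measure_ne_top_of_subset (h.subset j)
        (h.bounded j).measure_lt_top.ne)).trans_lt (h.volume_real_lt (by positivity) j)
    obtain ⟨U, hUm, hU, δ, hδ0, hδ⟩ := exists_measurable_ball_subset (hL j) hlt
    have hst : s * t / 2 ≤ s := by nlinarith
    obtain ⟨F, hF, hFd, hFc, hFv⟩ := exists_stopping_family hUm hδ0 hδ hs (h.interval j)
      (h.bounded j) ((hU (I j)).trans_le (by gcongr))
    refine ⟨F, fun J hJ => ⟨(hF J hJ).1, (hF J hJ).2.1, ?_⟩, hFd,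
      fun x hx => hFc ⟨hx, hLI j hx⟩, ?_⟩
    · refine (measureReal_mono (inter_subset_inter_left J fun x hx => hδ x hx
        (Metric.mem_ball_self hδ0)) ?_).trans_lt (hF J hJ).2.2
      exact measure_ne_top_of_subset (inter_subset_right.trans (hF J hJ).2.1)
        (h.bounded j).measure_lt_top.ne
    · have := hFv.trans_lt (hU (I j))
      by_contra hcon
      rw [not_lt] at hcon
      nlinarith [mul_le_mul_of_nonneg_left hcon hs0.le]
  choose F hF hFd hFc hFv using hF
  have hVI : ∀ j, ⋃ J ∈ F j, J ⊆ I j := fun j => iUnion₂_subset fun J hJ => (hF j J hJ).2.1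
  have h1 := primitive_le_lowerW_mul hu hu_pos hw hw_pos ht0.le h.interval h.bounded h.disjoint
    (S := fun j => ⋃ J ∈ F j, J)
    (fun j => (F j).measurableSet_biUnion fun J hJ => (hF j J hJ).1.measurableSet) hVI hFv
  have h2 := primitive_le_lowerW_mul hu hu_pos hw hw_pos hs0.le (κ := Σ j, F j)
    (I := fun q => q.2.1) (S := fun q => L q.1 ∩ q.2.1)
    (fun q => (hF q.1 _ q.2.2).1) (fun q => (h.bounded q.1).subset (hF q.1 _ q.2.2).2.1)
    (by
      rintro ⟨j, J, hJ⟩ ⟨j', J', hJ'⟩ hne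
      by_cases hjj : j = j'
      · subst hjj
        exact hFd j hJ hJ' fun h => hne (by subst h; rfl)
      · exact (h.disjoint hjj).mono (hF j J hJ).2.1 (hF j' J' hJ').2.1)
    (fun q => (hL q.1).measurableSet.inter (hF q.1 _ q.2.2).1.measurableSet)
    (fun q => inter_subset_right) (fun q => (hF q.1 _ q.2.2).2.2)
  have hU1 : ⋃ j, L j ⊆ ⋃ q : Σ j, F j, L q.1 ∩ q.2.1 := by
    refine iUnion_subset fun j x hx => ?_
    obtain ⟨J, hJ, hxJ⟩ := mem_iUnion₂.1 (hFc j hx)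
    exact mem_iUnion.2 ⟨⟨j, J, hJ⟩, hx, hxJ⟩
  have hU2 : ⋃ q : Σ j, F j, q.2.1 ⊆ ⋃ j, ⋃ J ∈ F j, J :=
    iUnion_subset fun q x hx => mem_iUnion.2 ⟨q.1, mem_iUnion₂.2 ⟨q.2.1, q.2.2, hx⟩⟩
  have hafin : weightMeasure u (⋃ j, L j) ≠ ∞ := (weightMeasure_lt_top hu
    ((Bornology.isBounded_iUnion.2 h.bounded).subset (iUnion_mono hLI))).ne
  refine ENNReal.div_le_of_le_mul ?_
  calc primitive w (weightMeasure u (⋃ j, S j))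
      ≤ primitive w (2 * weightMeasure u (⋃ j, L j)) := primitive_mono w hLu
    _ ≤ D * primitive w (weightMeasure u (⋃ j, L j)) := primitive_two_mul_le hD hafin
    _ ≤ D * (lowerW u w s * primitive w (weightMeasure u (⋃ q : Σ j, F j, q.2.1))) := by
        gcongr
        exact (primitive_mono w (measure_mono hU1)).trans h2
    _ ≤ D * (lowerW u w s * (lowerW u w t * primitive w (weightMeasure u (⋃ j, I j)))) := by
        gcongr
        exact (primitive_mono w (measure_mono hU2)).trans h1
    _ = D * (lowerW u w s * lowerW u w t) * primitive w (weightMeasure u (⋃ j, I j)) := by ring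

/-- Bisect `[0, 1]` and always keep the half of larger weighted measure. -/
theorem exists_interval_weightMeasure_le (u : ℝ → ℝ) (n : ℕ) :
    ∃ J : Set ℝ, J.OrdConnected ∧ J ⊆ Icc 0 1 ∧ volume.real J = (1 / 2) ^ n ∧
      weightMeasure u (Icc 0 1) ≤ 2 ^ n * weightMeasure u J := by
  induction n with
  | zero => exact ⟨Icc 0 1, ordConnected_Icc, subset_rfl, by simp, by simp⟩
  | succ n ih =>
    obtain ⟨J, hJ, hJI, hJv, hJu⟩ := ih
    obtain ⟨m, hl, hr⟩ := exists_bisection hJ ((Metric.isBounded_Icc 0 1).subset hJI)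
    have hadd : weightMeasure u J ≤ weightMeasure u (J ∩ Iio m) + weightMeasure u (J ∩ Ici m) := by
      refine (measure_mono fun x hx => ?_).trans (measure_union_le _ _)
      rcases lt_or_ge x m with h | h
      · exact Or.inl ⟨hx, h⟩
      · exact Or.inr ⟨hx, h⟩
    have hvol : volume.real J / 2 = (1 / 2) ^ (n + 1) := by
      rw [hJv]
      ring
    have hle : ∀ J' : Set ℝ, weightMeasure u J ≤ weightMeasure u J' + weightMeasure u J' →
        weightMeasure u (Icc 0 1) ≤ 2 ^ (n + 1) * weightMeasure u J' := fun J' h => by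
      refine hJu.trans ?_
      rw [pow_succ, mul_assoc, two_mul]
      gcongr
    rcases le_total (weightMeasure u (J ∩ Iio m)) (weightMeasure u (J ∩ Ici m)) with h | h
    · exact ⟨J ∩ Ici m, hJ.inter ordConnected_Ici, inter_subset_left.trans hJI, hr.trans hvol,
        hle _ (hadd.trans (by gcongr))⟩
    · exact ⟨J ∩ Iio m, hJ.inter ordConnected_Iio, inter_subset_left.trans hJI, hl.trans hvol,
        hle _ (hadd.trans (by gcongr))⟩

theorem one_le_pow_mul_lowerW (hu : LocallyIntegrable u volume)
    (hu_pos : ∀ᵐ x, 0 < u x) (hw : ∀ t : ℝ, 0 < t → IntegrableOn w (Ioc 0 t) volume)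
    (hw_pos : ∀ᵐ t ∂(volume.restrict (Ioi (0 : ℝ))), 0 < w t) {D : ℝ≥0}
    (hD : ∀ r : ℝ, 0 < r →
      primitive w (ENNReal.ofReal (2 * r)) ≤ D * primitive w (ENNReal.ofReal r)) (n : ℕ) :
    1 ≤ D ^ n * lowerW u w (2 * (1 / 2) ^ n) := by
  obtain ⟨J, hJ, hJI, hJv, hJu⟩ := exists_interval_weightMeasure_le u n
  have hfin : weightMeasure u (Icc 0 1) < ∞ := weightMeasure_lt_top hu (Metric.isBounded_Icc 0 1)
  have hJfin : weightMeasure u J ≠ ∞ := measure_ne_top_of_subset hJI hfin.ne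
  -- Admissibility is strict, so `|J| = 2⁻ⁿ` is tested at `2 * 2⁻ⁿ`; the same factor `2` turns `s *
  -- t / 2` into addition of exponents.
  have h := primitive_le_lowerW_mul hu hu_pos hw hw_pos (κ := Unit) (I := fun _ => Icc 0 1)
    (S := fun _ => J) (t := 2 * (1 / 2) ^ n) (by positivity) (fun _ => ordConnected_Icc)
    (fun _ => Metric.isBounded_Icc 0 1) (fun i j hij => absurd (Subsingleton.elim i j) hij)
    (fun _ => hJ.measurableSet) (fun _ => hJI) (fun _ => by
      have : (0 : ℝ) < (1 / 2) ^ n := by positivity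
      rw [hJv, Real.volume_real_Icc_of_le zero_le_one]
      linarith)
  rw [iUnion_const, iUnion_const] at h
  set b := primitive w (weightMeasure u (Icc 0 1)) with hb
  have hb0 : b ≠ 0 := (primitive_pos hw hw_pos (weightMeasure_pos hu hu_pos (by simp))).ne'
  have hbtop : b ≠ ∞ := (primitive_lt_top hw hfin.ne).ne
  rw [← ENNReal.mul_le_mul_iff_left hb0 hbtop, one_mul]
  calc b ≤ primitive w (2 ^ n * weightMeasure u J) := primitive_mono w hJu
    _ ≤ D ^ n * primitive w (weightMeasure u J) := primitive_two_pow_mul_le hD hJfin n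
    _ ≤ D ^ n * (lowerW u w (2 * (1 / 2) ^ n) * b) := by gcongr
    _ = D ^ n * lowerW u w (2 * (1 / 2) ^ n) * b := by ring

end LowerWBounds

/-! ### From dyadic scales to the continuous limit. -/

section Index

/-- Write `t = 2⁻ˣ` and squeeze `L t` between its values at `2 ^ (-(⌊x⌋ + 1))` and `2 ^ (-⌊x⌋)`. The
constant `C` contributes `log C / x → 0`. -/
theorem tendsto_log_div_log {L : ℝ → ℝ} (hmono : Monotone L) (hpos : ∀ t, 0 < t → 0 < L t)
    {C l : ℝ} (hC : 0 < C)
    (h : Tendsto (fun n : ℕ => Real.log (C * L (2 * (1 / 2) ^ n)) / n) atTop (𝓝 l)) :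
    Tendsto (fun t => Real.log (L t) / Real.log t) (𝓝[>] 0) (𝓝 (-l / Real.log 2)) := by
  have hlog2 : 0 < Real.log 2 := Real.log_pos one_lt_two
  set b : ℕ → ℝ := fun n => Real.log (C * L (2 * (1 / 2) ^ n)) with hb
  have hexp : ∀ n : ℕ, 2 * (1 / 2 : ℝ) ^ (n + 1) = Real.exp (-(n * Real.log 2)) := fun n => by
    rw [Real.exp_neg, mul_comm (n : ℝ), Real.exp_mul, Real.exp_log two_pos, Real.rpow_natCast,
      pow_succ, one_div, inv_pow]
    ring
  have hbL : ∀ n : ℕ, b (n + 1) = Real.log C + Real.log (L (Real.exp (-(n * Real.log 2)))) :=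
    fun n => by
      simp only [hb]
      rw [hexp, Real.log_mul hC.ne' (hpos _ (Real.exp_pos _)).ne']
  have hratio : ∀ k : ℕ, Tendsto (fun x : ℝ => (((⌊x⌋₊ + k : ℕ) : ℝ)) / x) atTop (𝓝 1) := by
    intro k
    have h1 := (tendsto_nat_floor_div_atTop (R := ℝ)).add
      (tendsto_const_nhds.div_atTop tendsto_id : Tendsto (fun x : ℝ => (k : ℝ) / x) atTop (𝓝 0))
    rw [add_zero] at h1
    refine h1.congr fun x => ?_
    push_cast
    ring
  -- Since `2 * 2⁻ⁿ = 2 ^ (-(n - 1))`, the indices are shifted by one: `k = 1` gives the lower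
  -- bound, `k = 0` the upper one.
  have hside : ∀ k : ℕ, Tendsto (fun x : ℝ => (b (⌊x⌋₊ + (k + 1)) - Real.log C) / x) atTop
      (𝓝 l) := by
    intro k
    have h1 : Tendsto (fun x : ℝ => ⌊x⌋₊ + (k + 1)) atTop atTop :=
      
      tendsto_atTop_mono (fun x => Nat.le_add_right _ _) tendsto_nat_floor_atTop
    have h2 := ((h.comp h1).mul (hratio (k + 1))).sub
      (tendsto_const_nhds.div_atTop tendsto_id :
        Tendsto (fun x : ℝ => Real.log C / x) atTop (𝓝 0))
    rw [mul_one, sub_zero] at h2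
    refine h2.congr fun x => ?_
    have hne : ((⌊x⌋₊ + (k + 1) : ℕ) : ℝ) ≠ 0 := by positivity
    rw [Function.comp_apply, div_mul_div_cancel₀ hne, sub_div]
  have hG : Tendsto (fun x : ℝ => Real.log (L (Real.exp (-(x * Real.log 2)))) / x) atTop
      (𝓝 l) := by
    refine tendsto_of_tendsto_of_tendsto_of_le_of_le' (hside 1) (hside 0) ?_ ?_
    · filter_upwards [eventually_gt_atTop 0] with x hx
      have hx1 := (Nat.lt_floor_add_one x).le
      rw [show ⌊x⌋₊ + (1 + 1) = (⌊x⌋₊ + 1) + 1 from rfl, hbL, add_sub_cancel_left]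
      refine div_le_div_of_nonneg_right (Real.log_le_log (hpos _ (Real.exp_pos _)) (hmono ?_)) hx.le
      rw [Real.exp_le_exp]
      push_cast
      nlinarith
    · filter_upwards [eventually_gt_atTop 0] with x hx
      have hx1 := Nat.floor_le hx.le
      rw [zero_add, hbL, add_sub_cancel_left]
      refine div_le_div_of_nonneg_right (Real.log_le_log (hpos _ (Real.exp_pos _)) (hmono ?_)) hx.le
      rw [Real.exp_le_exp]
      nlinarith
  have hφ : Tendsto (fun t : ℝ => -Real.log t / Real.log 2) (𝓝[>] 0) atTop :=
    (tendsto_neg_atBot_atTop.comp Real.tendsto_log_nhdsGT_zero).atTop_div_const hlog2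
  refine ((hG.comp hφ).neg.div_const (Real.log 2)).congr' ?_
  filter_upwards [self_mem_nhdsWithin] with t ht
  have ht : 0 < t := ht
  rw [Function.comp_apply, div_mul_cancel₀ _ hlog2.ne', neg_neg, Real.exp_log ht]
  rcases eq_or_ne (Real.log t) 0 with h0 | h0
  · simp [h0]
  · field_simp

end Index

end WeightedLorentz

/-! ### The index by Fekete's lemma. -/

open WeightedLorentz in
theorem mainTheorem5 (p : ℝ) (hp : 0 < p) (u w : ℝ → ℝ)
    (hu : LocallyIntegrable u volume) (hu_pos : ∀ᵐ x, 0 < u x)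
    (hw : ∀ t : ℝ, 0 < t → IntegrableOn w (Ioc 0 t) volume)
    (hw_pos : ∀ᵐ t ∂(volume.restrict (Ioi (0 : ℝ))), 0 < w t)
    (hw_delta : WeightedLorentz.DeltaTwo w)
    (hH : WeightedLorentz.HilbertBounded p u w) :
    ∃ β : ℝ, WeightedLorentz.HasLowerBoydIndex p u w β ∧ 0 < β := by
  obtain ⟨D₀, hD₀⟩ := id hw_delta
  -- Having `D ≥ 1` makes `log D` nonnegative, as used for `b 0` and for the lower bound of `b n /
  -- n`.
  set D : ℝ≥0 := max D₀ 1 with hDdef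
  have hD : ∀ r : ℝ, 0 < r →
      primitive w (ENNReal.ofReal (2 * r)) ≤ D * primitive w (ENNReal.ofReal r) := fun r hr =>
    (hD₀ r hr).trans (by gcongr; exact le_max_left _ _)
  have hD1 : (1 : ℝ) ≤ D := by exact_mod_cast le_max_right D₀ 1
  have hD0 : (0 : ℝ) < D := one_pos.trans_le hD1
  set L : ℝ → ℝ := fun t => (lowerW u w t).toReal with hL
  have hfin : ∀ t, lowerW u w t ≠ ∞ := fun t => ((lowerW_le_one u w t).trans_lt ENNReal.one_lt_top).ne
  have hLmono : Monotone L := fun s t hst => ENNReal.toReal_mono (hfin t) (lowerW_mono u w hst)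
  have hLlow : ∀ n : ℕ, 1 ≤ (D : ℝ) ^ n * L (2 * (1 / 2) ^ n) := fun n => by
    have := ENNReal.toReal_mono (ENNReal.mul_ne_top (by simp) (hfin _))
      (one_le_pow_mul_lowerW hu hu_pos hw hw_pos hD n)
    simpa using this
  have hLn : ∀ n : ℕ, 0 < L (2 * (1 / 2) ^ n) := fun n =>
    pos_of_mul_pos_right (one_pos.trans_le (hLlow n)) (by positivity)
  have hLpos : ∀ t, 0 < t → 0 < L t := fun t ht => by
    obtain ⟨n, hn⟩ := exists_pow_lt_of_lt_one (half_pos ht) (one_half_lt_one (α := ℝ))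
    exact (hLn n).trans_le (hLmono (by linarith))
  set b : ℕ → ℝ := fun n => Real.log (D * L (2 * (1 / 2) ^ n)) with hb
  -- Index `0` is the scale `2 > 1`, outside the range of quasi-submultiplicativity; there
  -- subadditivity only needs `b 0 ≥ 0`.
  have hb0 : 0 ≤ b 0 := Real.log_nonneg (by
    have := hLlow 0
    rw [pow_zero, one_mul] at this
    nlinarith)
  have hsub : Subadditive b := by
    intro m n
    rcases Nat.eq_zero_or_pos m with rfl | hm
    · rw [zero_add]
      linarith
    rcases Nat.eq_zero_or_pos n with rfl | hn
    · rw [add_zero]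
      linarith
    have hle : ∀ k : ℕ, 0 < k → 2 * (1 / 2 : ℝ) ^ k ≤ 1 := fun k hk => by
      obtain ⟨k, rfl⟩ := Nat.exists_eq_succ_of_ne_zero hk.ne'
      have : (1 / 2 : ℝ) ^ k ≤ 1 := pow_le_one₀ (by norm_num) (by norm_num)
      rw [pow_succ]
      linarith
    have hmul := ENNReal.toReal_mono
      (ENNReal.mul_ne_top ENNReal.coe_ne_top (ENNReal.mul_ne_top (hfin _) (hfin _)))
      (lowerW_mul_div_two_le hu hu_pos hw hw_pos hD
      (by positivity : (0 : ℝ) < 2 * (1 / 2) ^ m) (hle m hm)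
      (by positivity : (0 : ℝ) < 2 * (1 / 2) ^ n) (hle n hn))
    rw [ENNReal.toReal_mul, ENNReal.toReal_mul, ENNReal.coe_toReal,
      show 2 * (1 / 2 : ℝ) ^ m * (2 * (1 / 2) ^ n) / 2 = 2 * (1 / 2) ^ (m + n) by
        rw [pow_add]; ring] at hmul
    have hpm := mul_pos hD0 (hLn m)
    have hpn := mul_pos hD0 (hLn n)
    simp only [hb]
    rw [← Real.log_mul hpm.ne' hpn.ne']
    refine Real.log_le_log (mul_pos hD0 (hLn _)) ?_
    calc D * L (2 * (1 / 2) ^ (m + n))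
        ≤ D * (D * (L (2 * (1 / 2) ^ m) * L (2 * (1 / 2) ^ n))) := by gcongr
      _ = _ := by ring
  have hbdd : BddBelow (range fun n => b n / n) := by
    refine ⟨-Real.log D, ?_⟩
    rintro _ ⟨n, rfl⟩
    change -Real.log D ≤ b n / n
    rcases Nat.eq_zero_or_pos n with rfl | hn
    · simpa using Real.log_nonneg hD1
    · rw [le_div_iff₀ (by exact_mod_cast hn)]
      have h1 : 0 ≤ Real.log (D ^ n * L (2 * (1 / 2) ^ n)) := Real.log_nonneg (hLlow n)
      rw [Real.log_mul (by positivity) (hLn n).ne', Real.log_pow] at h1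
      simp only [hb]
      rw [Real.log_mul hD0.ne' (hLn n).ne']
      nlinarith [Real.log_nonneg hD1]
  have hneg : hsub.lim < 0 := by
    have hlim := (ENNReal.tendsto_toReal ENNReal.zero_ne_top).comp
      (tendsto_lowerW_eighth_pow hp hu hw hw_delta hH)
    obtain ⟨K, hK⟩ := (hlim.eventually_lt_const
      (by simpa using hD0 : ENNReal.toReal 0 < (D : ℝ)⁻¹)).exists
    -- The limit is at most every `b n / n` with `n ≠ 0`, so one negative term suffices; `n = 3 * K
    -- + 1` because `2 * 2⁻ⁿ` is then `8⁻ᴷ`.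
    refine (hsub.lim_le_div hbdd (n := 3 * K + 1) (by omega)).trans_lt ?_
    refine div_neg_of_neg_of_pos (Real.log_neg (mul_pos hD0 (hLn _)) ?_) (by positivity)
    have hpow : 2 * (1 / 2 : ℝ) ^ (3 * K + 1) = (1 / 8) ^ K := by
      rw [pow_succ, pow_mul]
      norm_num
      ring
    rw [hpow]
    exact (mul_lt_mul_of_pos_left hK hD0).trans_eq (mul_inv_cancel₀ hD0.ne')
  have hmain := (tendsto_log_div_log hLmono hLpos hD0 (hsub.tendsto_lim hbdd)).const_mul (1 / p)
  refine ⟨1 / p * (-hsub.lim / Real.log 2), ?_, ?_⟩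
  · refine hmain.congr' ?_
    filter_upwards [self_mem_nhdsWithin] with t ht
    rw [Real.log_rpow (hLpos t ht)]
    ring
  · have := Real.log_pos one_lt_two
    have : 0 < -hsub.lim := by linarith
    positivity
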